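/- **Setting.** There are $k\ge 1$ parties. Party $1$ is the host and parties $2,\dots,k$ are guests. A dataset consists of records $(x_i^1,\dots,x_i^k,y_i)$ with distinct aligned sample identifiers $i$ from a finite set. Party $j$ holds the features $x_i^j$, and the host also holds the labels $y_i$. Two datasets are *neighbouring* if they are equal or if one of them is the other with exactly one additional record. A randomized mechanism $\mathcal M$ is $(\varepsilon,\delta)$-*differentially private* if $\Pr[\mathcal M(D)\in S]\le e^{\varepsilon}\Pr[\mathcal M(D')\in S]+\delta$ for all neighbouring $D,D'$ and all measurable $S$. **FedOnce-L1** with sampling probability $q$, noise multiplier $\sigma$, clipping threshold $\Omega>0$ and $T_j$ epochs for party $j$ is the following mechanism. * *Step.* In each epoch $t$ a party draws a batch containing each identifier independently with probability $q$. It computes a gradient $\mathbf g$ on that batch, clips it, $\mathbf g_{clip}=\mathbf g/\max(1,\|\mathbf g\|_2/\Omega)$, and moves its parameter by $-\eta^{(t)}\bigl(\mathbf g_{clip}+\mathcal N(0,\sigma^2\Omega^2\mathbf I)\bigr)$. * *Guests* $j=2,\dots,k$ train independently of each other. They start from an initial parameter and random targets $C_j$ (one row per identifier), both drawn from laws that do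 not depend on the data. The gradient is that of $\theta_j\mapsto\frac1{2b}\|f_{\theta_j}(\mathbf x^j)-\tilde PC_j\|_F^2$, summed over the $b$ samples of the batch. Here $\tilde P$ is a permutation of the samples of the batch that minimizes this loss at the current $\theta_j$, and it is held fixed when differentiating. * *The host* then trains $w$, from an initial parameter drawn from a law independent of the data, with the gradient in $w$ of $\frac1{2b}\|f_w(\mathbf x^1,R_2,\dots,R_k)-\mathbf y\|_F^2$ on its batch, where $R_j=f_{\theta_j}(\mathbf x^j)$ comes from the final guest parameters. * The final parameters $(\theta_2,\dots,\theta_k,w)$ are released. The models are arbitrary, continuous in $\theta_j$ and in $(w,R_2,\dots,R_k)$ respectively; a gradient is read as $0$ where the loss is not differentiable. Dimensions, model functions, learning rates, $\Omega$, initial laws and target laws are arbitrary. Write $S=\sum_{j=1}^kT_j$. **Theorem.** There is an absolute constant $c_2>0$ with the following two properties. 1. For all $k$, all $T_1,\dots,T_k$ and all $0<q<1$ there is a constant $c_1>0$ (depending only on $k,T_1,\dots,T_k,q$) such that for every $0<\varepsilon<c_1q^2S$ and every $\delta>0$, FedOnce-L1 is $(\varepsilon,\delta)$-differentially private whenever $$\sigma\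 \ge\ c_2\,\frac{q\sqrt{\log(1/\delta)\,S}}{\varepsilon}.$$ (For $\delta>1$ the square root is read as $0$.) 2. If $\varepsilon\le\log(1/\delta)$ is also required, then $c_1$ can be taken absolute as well: there is an absolute $c_1>0$ such that for all $k$, all $T_1,\dots,T_k$, all $0<q\le1$, all $\delta>0$ and all $0<\varepsilon<c_1q^2S$ with $\varepsilon\le\log(1/\delta)$, FedOnce-L1 is $(\varepsilon,\delta)$-differentially private whenever $\sigma$ satisfies the same inequality. In both parts this holds for the released final parameters, and also for the collection of the parameters of all parties in all epochs. -/

import Mathlib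

open MeasureTheory ProbabilityTheory

noncomputable section

/-- Real vectors of length `d`, with the Euclidean norm. -/
abbrev Vec (d : ℕ) : Type := EuclideanSpace ℝ (Fin d)

/-! ### Datasets, neighbouring datasets, differential privacy -/

/-- A dataset whose records carry aligned sample identifiers in `Fin n`: `D i = some r` when sample
`i` is present with record `r`, and `D i = none` when sample `i` is absent. -/
abbrev Dataset (n : ℕ) (X : Type) : Type := Fin n → Option X

/-- `‖D - D'‖ ≤ 1`: the two datasets are equal, or one of them is the other with exactly one
additional record. -/
def Dataset.Neighbour {n : ℕ} {X : Type} (D D' : Dataset n X) : Prop :=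
  D = D' ∨
    (∃ i r, D i = none ∧ D' = Function.update D i (some r)) ∨
    (∃ i r, D' i = none ∧ D = Function.update D' i (some r))

/-- The batch formed by the samples of `D` whose identifiers lie in `J`. -/
def Dataset.batch {n : ℕ} {X : Type} (D : Dataset n X) (J : Finset (Fin n)) : Dataset n X :=
  fun i => if i ∈ J then D i else none

/-- The number of samples that are present. -/
def Dataset.size {n : ℕ} {X : Type} (D : Dataset n X) : ℕ :=
  (Finset.univ.filter fun i => (D i).isSome = true).card

/-- `(ε, δ)`-differential privacy of a randomized mechanism, given by its output distributions. -/
def IsDP {n : ℕ} {X Y : Type} [MeasurableSpace Y] (ε δ : ℝ)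
    (M : Dataset n X → Measure Y) : Prop :=
  ∀ D D' : Dataset n X, D.Neighbour D' → ∀ S : Set Y, MeasurableSet S →
    M D S ≤ ENNReal.ofReal (Real.exp ε) * M D' S + ENNReal.ofReal δ

/-! ### Differentially private stochastic gradient descent -/

/-- Gradient clipping `g / max(1, ‖g‖₂ / Ω)`. -/
def clip {d : ℕ} (Ω : ℝ) (g : Vec d) : Vec d := (max 1 (‖g‖ / Ω))⁻¹ • g

/-- One noisy step from the parameter `θ`: every identifier is sampled independently with
probability `q`, the gradient `grad B θ` on the resulting batch `B` is clipped to norm `Ω`, noise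
with law `N(0, σ² Ω² I)` is added to it, and a descent step of length `η` is made. -/
def noisyStep {n d : ℕ} {X : Type} (q σ Ω η : ℝ) (grad : Dataset n X → Vec d → Vec d)
    (D : Dataset n X) (θ : Vec d) : Measure (Vec d) :=
  ∑ J : Finset (Fin n), ENNReal.ofReal (q ^ J.card * (1 - q) ^ (n - J.card)) •
    (stdGaussian (Vec d)).map
      (fun z => θ - η • (clip Ω (grad (D.batch J) θ) + (σ * Ω) • z))

/-- The law of the parameters `θ⁽⁰⁾, …, θ⁽ᵀ⁾` visited in `T` successive random steps, where
`θ⁽⁰⁾` has law `init` and `θ⁽ᵗ⁺¹⁾` has law `step t θ⁽ᵗ⁾` given the past. -/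
def trajectory {d : ℕ} (init : Measure (Vec d)) (step : ℕ → Vec d → Measure (Vec d)) :
    (T : ℕ) → Measure (Fin (T + 1) → Vec d)
  | 0 => init.map (fun θ _ => θ)
  | T + 1 => (trajectory init step T).bind fun h =>
      (step T (h (Fin.last T))).map fun θ => (Fin.snoc h θ : Fin (T + 2) → Vec d)

/-! ### FedOnce -/

/-- The public specification of a FedOnce training task with one host party (index `0`), `m` guest
parties (indices `1, …, m`) and sample identifiers in `Fin n`: the models, the initialization laws
and the remaining hyperparameters. None of these depends on the training data. -/
structure FedOnce (m n : ℕ) where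
  /-- number of features held by each party -/
  featDim : Fin (m + 1) → ℕ
  /-- length of the labels, which the host holds -/
  labelDim : ℕ
  /-- length of the representations of each guest -/
  reprDim : Fin m → ℕ
  /-- number of parameters of each guest model -/
  guestDim : Fin m → ℕ
  /-- number of parameters of the host's aggregation model -/
  hostDim : ℕ
  /-- guest model `f_{θ_j}(x^j)` -/
  guestModel : (j : Fin m) → Vec (guestDim j) → Vec (featDim j.succ) → Vec (reprDim j)
  /-- the host's model `f_w(x^1, R_2, …, R_k)` -/
  hostModel : Vec hostDim → Vec (featDim 0) → ((j : Fin m) → Vec (reprDim j)) → Vec labelDim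
  guestModel_continuous : ∀ j x, Continuous fun θ => guestModel j θ x
  hostModel_continuous : ∀ x,
    Continuous fun p : Vec hostDim × ((j : Fin m) → Vec (reprDim j)) => hostModel p.1 x p.2
  /-- law of the initial guest parameters -/
  guestInit : (j : Fin m) → Measure (Vec (guestDim j))
  guestInit_prob : ∀ j, IsProbabilityMeasure (guestInit j)
  /-- law of the initial host parameters -/
  hostInit : Measure (Vec hostDim)
  hostInit_prob : IsProbabilityMeasure hostInit
  /-- law of the random targets `C_j`, one row for each sample identifier -/
  targetLaw : (j : Fin m) → Measure (Fin n → Vec (reprDim j))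
  targetLaw_prob : ∀ j, IsProbabilityMeasure (targetLaw j)
  /-- learning rates `η⁽ᵗ⁾` of the guests -/
  guestRate : Fin m → ℕ → ℝ
  /-- learning rates `η⁽ᵗ⁾` of the host -/
  hostRate : ℕ → ℝ
  /-- clipping threshold `Ω` -/
  clipNorm : ℝ
  clipNorm_pos : 0 < clipNorm

namespace FedOnce

variable {m n : ℕ} (F : FedOnce m n)

/-- A full record: the feature vectors `x_i^j` of all parties, and the label `y_i`. -/
abbrev Rec : Type := ((j : Fin (m + 1)) → Vec (F.featDim j)) × Vec F.labelDim

/-- The loss `(1 / 2b) ‖f_θ(x^j) - P C‖_F²` of guest `j` on a batch `B` of `b` samples, where the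
permutation `P` assigns the target `C (P i)` to sample `i`. -/
def guestLoss (j : Fin m) (C : Fin n → Vec (F.reprDim j)) (B : Dataset n F.Rec)
    (P : Equiv.Perm (Fin n)) (θ : Vec (F.guestDim j)) : ℝ :=
  1 / (2 * (B.size : ℝ)) * ∑ i, match B i with
    | none => 0
    | some r => ‖F.guestModel j θ (r.1 j.succ) - C (P i)‖ ^ 2

/-- The permutations of the samples of the batch `B` that minimize the loss at `θ`. -/
def bestPerms (j : Fin m) (C : Fin n → Vec (F.reprDim j)) (B : Dataset n F.Rec)
    (θ : Vec (F.guestDim j)) : Set (Equiv.Perm (Fin n)) :=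
  {P | (∀ i, B i = none → P i = i) ∧
    ∀ P' : Equiv.Perm (Fin n), (∀ i, B i = none → P' i = i) →
      F.guestLoss j C B P θ ≤ F.guestLoss j C B P' θ}

theorem bestPerms_nonempty (j : Fin m) (C : Fin n → Vec (F.reprDim j)) (B : Dataset n F.Rec)
    (θ : Vec (F.guestDim j)) : (F.bestPerms j C B θ).Nonempty := by
  obtain ⟨P, hP, hmin⟩ := Set.exists_min_image
    {P : Equiv.Perm (Fin n) | ∀ i, B i = none → P i = i} (fun P => F.guestLoss j C B P θ)
    (Set.toFinite _) ⟨1, fun _ _ => rfl⟩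
  exact ⟨P, hP, fun P' hP' => hmin P' hP'⟩

/-- The permutation `argmin_P (1 / 2b) ‖f_θ(x^j) - P C‖_F²`, with some fixed tie-breaking. -/
def bestPerm (j : Fin m) (C : Fin n → Vec (F.reprDim j)) (B : Dataset n F.Rec)
    (θ : Vec (F.guestDim j)) : Equiv.Perm (Fin n) :=
  (F.bestPerms_nonempty j C B θ).some

/-- The gradient of the loss of guest `j` in `θ`, the permutation being fixed at the optimal one. -/
def guestGrad (j : Fin m) (C : Fin n → Vec (F.reprDim j)) (B : Dataset n F.Rec)
    (θ : Vec (F.guestDim j)) : Vec (F.guestDim j) :=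
  gradient (F.guestLoss j C B (F.bestPerm j C B θ)) θ

/-- The host's loss `(1 / 2b) ‖f_w(x^1, R_2, …, R_k) - y‖_F²` on a batch of `b` samples, where
`R_j = f_{θ_j}(x^j)` is computed with the final guest parameters `θ_j`. -/
def hostLoss (Θ : (j : Fin m) → Vec (F.guestDim j)) (B : Dataset n F.Rec)
    (w : Vec F.hostDim) : ℝ :=
  1 / (2 * (B.size : ℝ)) * ∑ i, match B i with
    | none => 0
    | some r => ‖F.hostModel w (r.1 0) (fun j => F.guestModel j (Θ j) (r.1 j.succ)) - r.2‖ ^ 2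

/-- The gradient of the host's loss in `w`. -/
def hostGrad (Θ : (j : Fin m) → Vec (F.guestDim j)) (B : Dataset n F.Rec)
    (w : Vec F.hostDim) : Vec F.hostDim :=
  gradient (F.hostLoss Θ B) w

/-- Training of guest `j` for `T` epochs: the law of its parameters `θ_j⁽⁰⁾, …, θ_j⁽ᵀ⁾`. -/
def guestTraining (q σ : ℝ) (j : Fin m) (T : ℕ) (D : Dataset n F.Rec) :
    Measure (Fin (T + 1) → Vec (F.guestDim j)) :=
  (F.targetLaw j).bind fun C =>
    trajectory (F.guestInit j)
      (fun t => noisyStep q σ F.clipNorm (F.guestRate j t) (F.guestGrad j C) D) T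

/-- Training of the host for `T` epochs, given the final guest parameters `Θ`: the law of its
parameters `w⁽⁰⁾, …, w⁽ᵀ⁾`. -/
def hostTraining (q σ : ℝ) (Θ : (j : Fin m) → Vec (F.guestDim j)) (T : ℕ) (D : Dataset n F.Rec) :
    Measure (Fin (T + 1) → Vec F.hostDim) :=
  trajectory F.hostInit
    (fun t => noisyStep q σ F.clipNorm (F.hostRate t) (F.hostGrad Θ) D) T

/-- The parameters of all parties in all epochs, when party `j` trains for `T j` epochs. -/
abbrev Transcript (T : Fin (m + 1) → ℕ) : Type :=
  ((j : Fin m) → Fin (T j.succ + 1) → Vec (F.guestDim j)) × (Fin (T 0 + 1) → Vec F.hostDim)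

/-- FedOnce-L1: the guests train in parallel and independently of each other, then the host trains
on its own data and on the representations given by the final guest models. This is the joint law
of all parameters of all parties in all epochs. -/
def run (T : Fin (m + 1) → ℕ) (q σ : ℝ) (D : Dataset n F.Rec) : Measure (F.Transcript T) :=
  (Measure.pi fun j : Fin m => F.guestTraining q σ j (T j.succ) D).bind fun h =>
    (F.hostTraining q σ (fun j => h j (Fin.last _)) (T 0) D).map fun w => (h, w)

/-- What FedOnce-L1 returns: the law of the final parameters `θ_2, …, θ_k, w`. -/
def release (T : Fin (m + 1) → ℕ) (q σ : ℝ) (D : Dataset n F.Rec) :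
    Measure (((j : Fin m) → Vec (F.guestDim j)) × Vec F.hostDim) :=
  (F.run T q σ D).map fun p => (fun j => p.1 j (Fin.last _), p.2 (Fin.last _))

end FedOnce

end

/-! This is a moments-accountant argument. For neighbouring datasets, order `α` moments of the
likelihood ratio between the two transcripts are bounded, and a Markov-type estimate turns them into
`(ε, δ)`-privacy. Moments are encoded by duality in `HolderDom`, so no density of a transcript is
ever needed, and constants multiply under adaptive composition (`HolderDom.bind`). Since every step
has the same bound for every current parameter, FedOnce-L1 costs exactly `S = ∑ j, T j` steps
(`FedOnce.holderDom_run`).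

For one step, condition on the sampling of all identifiers except the differing one. What remains
compares `N(0, I)` with `(1 - q) N(0, I) + q N(v, I)`, where clipping forces `‖v‖ ≤ 2 / σ`. The
likelihood ratio is `1 + u` with `u` of mean zero, so its moments are `1 + O(α² q² / σ²)`. This is
uniform in the dimension as long as `α (2 / σ) ^ 2 ≤ 1 / 32`, because only the component along `v`
matters.

With `L = log (1 / δ)`, an order of size `L / ε` gives privacy when `ε ≤ L`
(`FedOnce.isDP_run_of_le_log`). If `ε > L` and `ε` is below `(1 - q) ^ S`, then `δ` is at least the
probability that the differing record is ever sampled, and privacy holds for any noise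
(`FedOnce.isDP_run_of_never_sampled`). This second regime is what makes `c₁` depend on `q` and `S`
in the first property. -/

open scoped ENNReal

/-! ### Hölder domination of measures and its stability. -/

/-- `P` is dominated by `Q` in the sense of Hölder's inequality with exponent `β`. For
`β = α / (α - 1)` and `P ≪ Q` this says that the `α`-th moment of `dP/dQ` under `Q` is at
most `A ^ α`; for `β = 1` it says that `P ≤ A • Q`. -/
def HolderDom {Y : Type*} [MeasurableSpace Y] (β : ℝ) (A : ℝ≥0∞) (P Q : Measure Y) : Prop :=
  ∀ h : Y → ℝ≥0∞, Measurable h → ∫⁻ y, h y ∂P ≤ A * (∫⁻ y, h y ^ β ∂Q) ^ β⁻¹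

namespace HolderDom

variable {Y Z : Type*} [MeasurableSpace Y] [MeasurableSpace Z] {β : ℝ} {A B : ℝ≥0∞}

theorem refl (hβ : 1 ≤ β) (P : Measure Y) [IsProbabilityMeasure P] : HolderDom β 1 P P := by
  intro h hh
  rcases hβ.eq_or_lt with rfl | hβ
  · simp
  · have := ENNReal.lintegral_mul_le_Lp_mul_Lq P (Real.HolderConjugate.conjExponent hβ)
      hh.aemeasurable (aemeasurable_const (b := (1 : ℝ≥0∞)))
    simpa using this

theorem map {P Q : Measure Y} (hPQ : HolderDom β A P Q) {f : Y → Z} (hf : Measurable f) :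
    HolderDom β A (P.map f) (Q.map f) := by
  intro h hh
  rw [lintegral_map hh hf, lintegral_map (by fun_prop) hf]
  exact hPQ _ (hh.comp hf)

/-- Adaptive composition. The kernel bound is applied at each `y`, then the bound for `P` is applied
to `y ↦ (∫ h ^ β ∂K' y) ^ β⁻¹`; the outer power `β` cancels the inner `β⁻¹`, so the constants
multiply without loss. -/
theorem bind (hβ : 0 < β) {P Q : Measure Y} (hPQ : HolderDom β A P Q) {K K' : Y → Measure Z}
    (hK : Measurable K) (hK' : Measurable K') (hKK' : ∀ y, HolderDom β B (K y) (K' y)) :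
    HolderDom β (A * B) (P.bind K) (Q.bind K') := by
  intro h hh
  have hhβ : Measurable fun z => h z ^ β := by fun_prop
  have hint : Measurable fun y => ∫⁻ z, h z ^ β ∂K' y :=
    (Measure.measurable_lintegral hhβ).comp hK'
  rw [Measure.lintegral_bind hK.aemeasurable hh.aemeasurable,
    Measure.lintegral_bind hK'.aemeasurable hhβ.aemeasurable]
  calc ∫⁻ y, ∫⁻ z, h z ∂K y ∂P
      ≤ ∫⁻ y, B * (∫⁻ z, h z ^ β ∂K' y) ^ β⁻¹ ∂P := lintegral_mono fun y => hKK' y h hh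
    _ = B * ∫⁻ y, (∫⁻ z, h z ^ β ∂K' y) ^ β⁻¹ ∂P := lintegral_const_mul _ (by fun_prop)
    _ ≤ B * (A * (∫⁻ y, ((∫⁻ z, h z ^ β ∂K' y) ^ β⁻¹) ^ β ∂Q) ^ β⁻¹) := by
        gcongr
        exact hPQ _ (by fun_prop)
    _ = A * B * (∫⁻ y, ∫⁻ z, h z ^ β ∂K' y ∂Q) ^ β⁻¹ := by
        simp_rw [← ENNReal.rpow_mul, inv_mul_cancel₀ hβ.ne', ENNReal.rpow_one]
        ring

/-- Concavity of `x ↦ x ^ β⁻¹` moves the average inside the power. This allows conditioning on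
randomness that has the same law for both datasets. -/
theorem sum_smul {ι : Type*} (hβ : 1 ≤ β) {s : Finset ι} {w : ι → ℝ≥0∞} (hw : ∑ i ∈ s, w i = 1)
    {P Q : ι → Measure Y} (hPQ : ∀ i ∈ s, HolderDom β A (P i) (Q i)) :
    HolderDom β A (∑ i ∈ s, w i • P i) (∑ i ∈ s, w i • Q i) := by
  intro h hh
  have hβ0 : 0 < β := zero_lt_one.trans_le hβ
  simp only [lintegral_finsetSum_measure, lintegral_smul_measure, smul_eq_mul]
  calc ∑ i ∈ s, w i * ∫⁻ y, h y ∂P i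
      ≤ ∑ i ∈ s, w i * (A * (∫⁻ y, h y ^ β ∂Q i) ^ β⁻¹) := by
        gcongr with i hi
        exact hPQ i hi h hh
    _ = A * ∑ i ∈ s, w i * (∫⁻ y, h y ^ β ∂Q i) ^ β⁻¹ := by
        rw [Finset.mul_sum]
        exact Finset.sum_congr rfl fun i _ => by ring
    _ ≤ A * (∑ i ∈ s, w i * ∫⁻ y, h y ^ β ∂Q i) ^ β⁻¹ := by
        gcongr
        rw [ENNReal.le_rpow_inv_iff hβ0]
        refine (ENNReal.rpow_arith_mean_le_arith_mean_rpow s w _ hw hβ).trans_eq ?_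
        simp_rw [← ENNReal.rpow_mul, inv_mul_cancel₀ hβ0.ne', ENNReal.rpow_one]

theorem prod (hβ : 0 < β) {P Q : Measure Y} {P' Q' : Measure Z} [SFinite P'] [SFinite Q']
    (h : HolderDom β A P Q) (h' : HolderDom β B P' Q') :
    HolderDom β (A * B) (P.prod P') (Q.prod Q') := by
  rw [Measure.prod, Measure.prod]
  exact h.bind hβ Measurable.map_prodMk_left Measurable.map_prodMk_left
    fun _ => h'.map measurable_prodMk_left

theorem pi (hβ : 0 < β) {m : ℕ} {E : Fin m → Type*} [∀ i, MeasurableSpace (E i)]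
    {A : Fin m → ℝ≥0∞} {P Q : (i : Fin m) → Measure (E i)} [∀ i, SigmaFinite (P i)]
    [∀ i, SigmaFinite (Q i)] (h : ∀ i, HolderDom β (A i) (P i) (Q i)) :
    HolderDom β (∏ i, A i) (Measure.pi P) (Measure.pi Q) := by
  induction m with
  | zero =>
    intro f _
    rw [Measure.pi_of_empty, Measure.pi_of_empty]
    simp [← ENNReal.rpow_mul, hβ.ne']
  | succ m ih =>
    have key := ((h 0).prod hβ (ih fun i => h i.succ)).map
      (MeasurableEquiv.piFinSuccAbove E 0).symm.measurable
    rw [Fin.prod_univ_succ]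
    have e₁ := (measurePreserving_piFinSuccAbove P 0).symm.map_eq
    have e₂ := (measurePreserving_piFinSuccAbove Q 0).symm.map_eq
    rw [← e₁, ← e₂]
    exact key

end HolderDom

/-! ### Elementary inequalities for the likelihood ratio. -/

/-- The linear term is kept exact because it will integrate to zero; only the quadratic remainder is
estimated, crudely, by induction. -/
theorem one_add_pow_le_add_sq {t M : ℝ} (ht : -1 ≤ t) (hM : 1 ≤ M) (htM : 1 + t ≤ M) (n : ℕ) :
    (1 + t) ^ n ≤ 1 + n * t + n ^ 2 * (t ^ 2 * M ^ n) := by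
  induction n with
  | zero => simp
  | succ n ih =>
    have h1 : (1 + t) * M ^ n ≤ M ^ (n + 1) := by
      rw [pow_succ']
      gcongr
    have h2 : (1 : ℝ) ≤ M ^ (n + 1) := one_le_pow₀ hM
    have hn : (0 : ℝ) ≤ n := n.cast_nonneg
    calc (1 + t) ^ (n + 1) = (1 + t) * (1 + t) ^ n := pow_succ' _ _
      _ ≤ (1 + t) * (1 + n * t + n ^ 2 * (t ^ 2 * M ^ n)) := by
          gcongr
          linarith
      _ = 1 + (n + 1) * t + n * t ^ 2 * 1 + n ^ 2 * t ^ 2 * ((1 + t) * M ^ n) := by ring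
      _ ≤ 1 + (n + 1) * t + n * t ^ 2 * M ^ (n + 1) + n ^ 2 * t ^ 2 * M ^ (n + 1) := by gcongr
      _ ≤ 1 + (n + 1) * t + (n + 1) ^ 2 * (t ^ 2 * M ^ (n + 1)) := by
          have : 0 ≤ (n + 1) * (t ^ 2 * M ^ (n + 1)) := by positivity
          linarith
      _ = _ := by push_cast; ring

theorem inv_one_add_pow_le_add_sq {t M : ℝ} (ht : -1 < t) (hM : 1 ≤ M) (htM : (1 + t)⁻¹ ≤ M)
    (n : ℕ) : ((1 + t)⁻¹) ^ n ≤ 1 - n * t + n ^ 2 * (t ^ 2 * M ^ n) := by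
  have h0 : 0 < 1 + t := by linarith
  set s := (1 + t)⁻¹ with hs
  have hs0 : 0 < s := inv_pos.2 h0
  have hst : s * (1 + t) = 1 := inv_mul_cancel₀ h0.ne'
  induction n with
  | zero => simp
  | succ n ih =>
    have h1 : s * M ^ n ≤ M ^ (n + 1) := by
      rw [pow_succ']
      gcongr
    have h2 : s ≤ M ^ (n + 1) := htM.trans (le_self_pow₀ hM n.succ_ne_zero)
    have hn : (0 : ℝ) ≤ n := n.cast_nonneg
    have h3 : s * (1 - n * t) = 1 - (n + 1) * t + (n + 1) * t ^ 2 * s := by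
      linear_combination (1 - (n + 1) * t) * hst
    calc s ^ (n + 1) = s * s ^ n := pow_succ' _ _
      _ ≤ s * (1 - n * t + n ^ 2 * (t ^ 2 * M ^ n)) := by gcongr
      _ = 1 - (n + 1) * t + (n + 1) * t ^ 2 * s + n ^ 2 * t ^ 2 * (s * M ^ n) := by
          rw [mul_add, h3]; ring
      _ ≤ 1 - (n + 1) * t + (n + 1) * t ^ 2 * M ^ (n + 1) + n ^ 2 * t ^ 2 * M ^ (n + 1) := by
          gcongr
      _ ≤ 1 - (n + 1) * t + (n + 1) ^ 2 * (t ^ 2 * M ^ (n + 1)) := by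
          have : 0 ≤ n * (t ^ 2 * M ^ (n + 1)) := by positivity
          linarith
      _ = _ := by push_cast; ring

theorem abs_exp_sub_one_le_mul_exp (x : ℝ) : |Real.exp x - 1| ≤ |x| * Real.exp |x| := by
  have h : Real.exp |x| - 1 ≤ |x| * Real.exp |x| := by
    have h1 := Real.add_one_le_exp (-|x|)
    have h2 : Real.exp (-|x|) * Real.exp |x| = 1 := by rw [← Real.exp_add]; simp
    nlinarith [Real.exp_pos |x|]
  refine le_trans ?_ h
  rcases le_total 0 x with hx | hx
  · rw [abs_of_nonneg hx, abs_of_nonneg (by linarith [Real.one_le_exp hx])]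
  · rw [abs_of_nonpos hx, abs_of_nonpos (by linarith [Real.exp_le_one_iff.2 hx])]
    have h2 : Real.exp (-x) * Real.exp x = 1 := by rw [← Real.exp_add]; simp
    nlinarith [sq_nonneg (Real.exp x - 1), Real.exp_pos (-x), Real.one_le_exp (neg_nonneg.2 hx)]

/-- The linear term keeps its factor `q`, so an `n`-th power with `y` of order `a` costs `n q a`
rather than `n a`; the term `y ^ 2` is harmless when `n a²` is bounded. For `y ≤ 1` one has `exp y -
1 ≤ 2 y`, and for `y ≥ 1` one has `exp y ≤ exp (y ^ 2)`. -/
theorem one_add_mul_exp_sub_one_le {q y : ℝ} (hq₀ : 0 ≤ q) (hq₁ : q ≤ 1) (hy : 0 ≤ y) :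
    1 + q * (Real.exp y - 1) ≤ Real.exp (2 * q * y + y ^ 2) := by
  rcases le_total y 1 with h | h
  · have h1 := (le_abs_self _).trans (Real.abs_exp_sub_one_le (x := y) (by rwa [abs_of_nonneg hy]))
    rw [abs_of_nonneg hy] at h1
    have h2 := Real.add_one_le_exp (2 * q * y + y ^ 2)
    nlinarith [mul_le_mul_of_nonneg_left h1 hq₀, sq_nonneg y]
  · have h1 : 1 + q * (Real.exp y - 1) ≤ Real.exp y := by nlinarith [Real.one_le_exp hy]
    refine h1.trans (Real.exp_le_exp.2 ?_)
    nlinarith [mul_nonneg hq₀ hy]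

theorem one_add_mul_exp_sub_one_pos {q : ℝ} (hq₀ : 0 ≤ q) (hq₁ : q ≤ 1) (x : ℝ) :
    0 < 1 + q * (Real.exp x - 1) := by
  rcases hq₀.eq_or_lt with rfl | h
  · simp
  · nlinarith [mul_pos h (Real.exp_pos x)]

/-- Jensen's inequality for `t ↦ t⁻¹` on the mixture of `1` and `exp x`. It bounds the reciprocal
ratio by an expression of the same form, so both kinds of moments share one remainder estimate. -/
theorem inv_one_add_mul_exp_sub_one_le {q : ℝ} (hq₀ : 0 ≤ q) (hq₁ : q ≤ 1) (x : ℝ) :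
    (1 + q * (Real.exp x - 1))⁻¹ ≤ 1 + q * (Real.exp (-x) - 1) := by
  rw [inv_le_iff_one_le_mul₀ (one_add_mul_exp_sub_one_pos hq₀ hq₁ x)]
  have h : Real.exp (-x) * Real.exp x = 1 := by rw [← Real.exp_add]; simp
  have h2 : 2 ≤ Real.exp x + Real.exp (-x) := by
    nlinarith [sq_nonneg (Real.exp x - 1), Real.exp_pos (-x)]
  have h3 := mul_nonneg (mul_nonneg hq₀ (sub_nonneg.2 hq₁)) (sub_nonneg.2 h2)
  have h4 : (1 + q * (Real.exp (-x) - 1)) * (1 + q * (Real.exp x - 1)) =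
      1 + q * (1 - q) * (Real.exp x + Real.exp (-x) - 2) := by linear_combination q ^ 2 * h
  linarith

theorem one_add_mul_exp_sub_one_mono {q x y : ℝ} (hq₀ : 0 ≤ q) (hxy : x ≤ y) :
    1 + q * (Real.exp x - 1) ≤ 1 + q * (Real.exp y - 1) := by
  gcongr

/-- The second-order remainder of the moments of a subsampled Gaussian likelihood ratio. -/
theorem subsampled_remainder_le {n : ℕ} (hn : 1 ≤ n) {q a : ℝ} (hq₀ : 0 ≤ q) (hq₁ : q ≤ 1)
    (ha : 0 ≤ a) (hna : n * a ^ 2 ≤ 1 / 32) (z : ℝ) :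
    (q * (Real.exp (a * z - a ^ 2 / 2) - 1)) ^ 2 *
        (1 + q * (Real.exp |a * z - a ^ 2 / 2| - 1)) ^ n ≤
      32 * Real.exp (5 / 4) * (q ^ 2 * a ^ 2 * Real.exp (32 * (n ^ 2 * q ^ 2 * a ^ 2))) *
        Real.exp (z ^ 2 / 4) := by
  set x := a * z - a ^ 2 / 2 with hx
  set r := |z| + 1 with hr
  have hn' : (1 : ℝ) ≤ n := by exact_mod_cast hn
  have ha2 : a ^ 2 ≤ 1 / 32 := by nlinarith [sq_nonneg a]
  have ha1 : a ≤ 1 := by nlinarith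
  have hr0 : 0 ≤ r := by positivity
  have hxr : |x| ≤ a * r := by
    have h1 : |x| ≤ |a * z| + |a ^ 2 / 2| := abs_sub _ _
    rw [abs_mul, abs_of_nonneg ha, abs_of_nonneg (by positivity : 0 ≤ a ^ 2 / 2)] at h1
    nlinarith
  have hu : (Real.exp x - 1) ^ 2 ≤ (a * r * Real.exp (a * r)) ^ 2 := by
    rw [← sq_abs]
    gcongr
    exact (abs_exp_sub_one_le_mul_exp x).trans (by gcongr)
  have hM : (1 + q * (Real.exp |x| - 1)) ^ n ≤ Real.exp (n * (2 * q * (a * r) + (a * r) ^ 2)) := by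
    rw [Real.exp_nat_mul]
    have h0 : 0 ≤ Real.exp |x| - 1 := by linarith [Real.one_le_exp (abs_nonneg x)]
    gcongr
    exact (one_add_mul_exp_sub_one_mono hq₀ hxr).trans
      (one_add_mul_exp_sub_one_le hq₀ hq₁ (by positivity))
  -- The factor `r ^ 2` and the three terms of the exponent cost `r ^ 2 / 32` each, hence `r ^ 2 /
  -- 8` in total. By `hz` this is at most `z ^ 2 / 4 + 1 / 4`, which stays integrable against the
  -- Gaussian weight `exp (-z ^ 2 / 2)`; the `5 / 4` collects the additive constants.
  have hr2 : r ^ 2 ≤ 32 * Real.exp (r ^ 2 / 32) := by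
    linarith [Real.add_one_le_exp (r ^ 2 / 32)]
  have hz : r ^ 2 / 8 ≤ z ^ 2 / 4 + 1 / 4 := by
    nlinarith [sq_nonneg (|z| - 1), sq_abs z]
  have h1 : 2 * (a * r) ≤ 1 + r ^ 2 / 32 := by nlinarith [sq_nonneg (32 * a - r)]
  have h2 : n * (2 * q * (a * r)) ≤ 32 * (n ^ 2 * q ^ 2 * a ^ 2) + r ^ 2 / 32 := by
    nlinarith [sq_nonneg (32 * (n * q * a) - r)]
  have h3 : n * (a * r) ^ 2 ≤ r ^ 2 / 32 := by nlinarith [sq_nonneg r]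
  have h0 : 0 ≤ Real.exp |x| - 1 := by linarith [Real.one_le_exp (abs_nonneg x)]
  calc (q * (Real.exp x - 1)) ^ 2 * (1 + q * (Real.exp |x| - 1)) ^ n
      = q ^ 2 * (Real.exp x - 1) ^ 2 * (1 + q * (Real.exp |x| - 1)) ^ n := by ring
    _ ≤ q ^ 2 * (a * r * Real.exp (a * r)) ^ 2 *
          Real.exp (n * (2 * q * (a * r) + (a * r) ^ 2)) := by gcongr
    _ = q ^ 2 * a ^ 2 * (r ^ 2 * Real.exp (2 * (a * r) + n * (2 * q * (a * r)) +
          n * (a * r) ^ 2)) := by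
        rw [mul_pow, ← Real.exp_nat_mul, mul_add (n : ℝ), add_assoc, Real.exp_add (2 * (a * r))]
        push_cast
        ring
    _ ≤ q ^ 2 * a ^ 2 * (32 * Real.exp (r ^ 2 / 32) * Real.exp ((1 + r ^ 2 / 32) +
          (32 * (n ^ 2 * q ^ 2 * a ^ 2) + r ^ 2 / 32) + r ^ 2 / 32)) := by gcongr
    _ = 32 * (q ^ 2 * a ^ 2) *
          Real.exp (1 + 32 * (n ^ 2 * q ^ 2 * a ^ 2) + r ^ 2 / 8) := by
        rw [mul_assoc 32, ← Real.exp_add]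
        ring_nf
    _ ≤ 32 * (q ^ 2 * a ^ 2) *
          Real.exp (1 + 32 * (n ^ 2 * q ^ 2 * a ^ 2) + (z ^ 2 / 4 + 1 / 4)) := by gcongr
    _ = _ := by
        rw [show 1 + 32 * (n ^ 2 * q ^ 2 * a ^ 2) + (z ^ 2 / 4 + 1 / 4) =
          5 / 4 + 32 * (n ^ 2 * q ^ 2 * a ^ 2) + z ^ 2 / 4 by ring, Real.exp_add, Real.exp_add]
        ring

/-! ### Gaussian moments of the subsampled likelihood ratio. -/

theorem integrable_exp_sq_div_four_gaussianReal :
    Integrable (fun z : ℝ => Real.exp (z ^ 2 / 4)) (gaussianReal 0 1) := by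
  rw [gaussianReal_of_var_ne_zero _ one_ne_zero,
    integrable_withDensity_iff (measurable_gaussianPDF _ _)
      (Filter.Eventually.of_forall fun _ => gaussianPDF_lt_top)]
  have h := ((integrable_exp_neg_mul_sq (b := 1 / 4) (by norm_num)).const_mul
    (√(2 * Real.pi))⁻¹)
  refine h.congr (Filter.Eventually.of_forall fun z => ?_)
  simp only [toReal_gaussianPDF, gaussianPDFReal_def, NNReal.coe_one, mul_one, sub_zero]
  rw [mul_left_comm, ← Real.exp_add]
  ring_nf

theorem integrable_exp_shift_gaussianReal (a : ℝ) :
    Integrable (fun z => Real.exp (a * z - a ^ 2 / 2)) (gaussianReal 0 1) := by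
  simp_rw [sub_eq_add_neg, Real.exp_add]
  exact (integrable_exp_mul_gaussianReal a).mul_const _

theorem integral_exp_shift_gaussianReal (a : ℝ) :
    ∫ z, Real.exp (a * z - a ^ 2 / 2) ∂gaussianReal 0 1 = 1 := by
  have h := congrFun (mgf_fun_id_gaussianReal (μ := 0) (v := 1)) a
  simp only [mgf, zero_mul, zero_add, NNReal.coe_one, one_mul] at h
  simp_rw [sub_eq_add_neg, Real.exp_add, integral_mul_const]
  rw [h, ← Real.exp_add]
  simp

/-- The constant in the moment bounds for the subsampled Gaussian mechanism. -/
noncomputable def subsampledConst : ℝ :=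
  32 + 32 * Real.exp (5 / 4) * ∫ z, Real.exp (z ^ 2 / 4) ∂gaussianReal 0 1

theorem subsampledConst_pos : 0 < subsampledConst := by
  have : 0 ≤ ∫ z, Real.exp (z ^ 2 / 4) ∂gaussianReal 0 1 := integral_nonneg fun z => by positivity
  unfold subsampledConst
  positivity

/-- The shifted Gaussian density has integral one, so the linear term vanishes for every coefficient
`s`: positive moments take `s = n`, negative ones `s = -n`. What remains is `1 + c K t exp (32 t)`,
at most `exp (32 t) (1 + c K t)`, which explains both summands of `subsampledConst`. -/
theorem lintegral_le_exp_of_le_remainder {n : ℕ} (hn : 1 ≤ n) {q a : ℝ} (hq₀ : 0 ≤ q) (hq₁ : q ≤ 1)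
    (ha : 0 ≤ a) (hna : n * a ^ 2 ≤ 1 / 32) (s : ℝ) {f : ℝ → ℝ}
    (hf₀ : ∀ z, 0 ≤ f z)
    (hf : ∀ z, f z ≤ 1 + s * (q * (Real.exp (a * z - a ^ 2 / 2) - 1)) +
      n ^ 2 * ((q * (Real.exp (a * z - a ^ 2 / 2) - 1)) ^ 2 *
        (1 + q * (Real.exp |a * z - a ^ 2 / 2| - 1)) ^ n)) :
    ∫⁻ z, ENNReal.ofReal (f z) ∂gaussianReal 0 1 ≤
      ENNReal.ofReal (Real.exp (subsampledConst * (n ^ 2 * q ^ 2 * a ^ 2))) := by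
  set t := (n : ℝ) ^ 2 * q ^ 2 * a ^ 2 with ht
  have ht0 : 0 ≤ t := by positivity
  set c := 32 * Real.exp (5 / 4) with hc
  set g : ℝ → ℝ := fun z => 1 + s * q * (Real.exp (a * z - a ^ 2 / 2) - 1) +
    c * (t * Real.exp (32 * t)) * Real.exp (z ^ 2 / 4) with hg
  have hi₁ : Integrable (fun z => s * q * (Real.exp (a * z - a ^ 2 / 2) - 1)) (gaussianReal 0 1) :=
    ((integrable_exp_shift_gaussianReal a).sub (integrable_const 1)).const_mul _
  have hi₂ : Integrable (fun z => c * (t * Real.exp (32 * t)) * Real.exp (z ^ 2 / 4))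
      (gaussianReal 0 1) := integrable_exp_sq_div_four_gaussianReal.const_mul _
  have hi₃ : Integrable (fun z => 1 + s * q * (Real.exp (a * z - a ^ 2 / 2) - 1))
      (gaussianReal 0 1) := (integrable_const 1).add hi₁
  have hfg : ∀ z, f z ≤ g z := by
    intro z
    refine (hf z).trans ?_
    have := mul_le_mul_of_nonneg_left (subsampled_remainder_le hn hq₀ hq₁ ha hna z)
      (sq_nonneg (n : ℝ))
    simp only [hg]
    rw [← ht] at this
    calc _ ≤ _ := add_le_add_right this _
      _ = _ := by rw [ht]; ring
  have hgint : ∫ z, g z ∂gaussianReal 0 1 =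
      1 + c * (∫ z, Real.exp (z ^ 2 / 4) ∂gaussianReal 0 1) * (t * Real.exp (32 * t)) := by
    rw [integral_add hi₃ hi₂, integral_add (integrable_const 1) hi₁, integral_const_mul,
      integral_const_mul, integral_sub (integrable_exp_shift_gaussianReal a) (integrable_const 1),
      integral_exp_shift_gaussianReal]
    simp
    ring
  have hK : 0 ≤ ∫ z, Real.exp (z ^ 2 / 4) ∂gaussianReal 0 1 :=
    integral_nonneg fun z => by positivity
  have hbound : ∫ z, g z ∂gaussianReal 0 1 ≤ Real.exp (subsampledConst * t) := by
    rw [hgint]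
    set K := ∫ z, Real.exp (z ^ 2 / 4) ∂gaussianReal 0 1
    have e : subsampledConst * t = 32 * t + c * K * t := by
      simp only [subsampledConst]; ring
    rw [e, Real.exp_add]
    have h1 : 1 ≤ Real.exp (32 * t) := Real.one_le_exp (by positivity)
    have h2 := Real.add_one_le_exp (c * K * t)
    nlinarith
  calc ∫⁻ z, ENNReal.ofReal (f z) ∂gaussianReal 0 1
      ≤ ∫⁻ z, ENNReal.ofReal (g z) ∂gaussianReal 0 1 :=
        lintegral_mono fun z => ENNReal.ofReal_le_ofReal (hfg z)
    _ = ENNReal.ofReal (∫ z, g z ∂gaussianReal 0 1) :=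
        (ofReal_integral_eq_lintegral_ofReal (hi₃.add hi₂)
          (Filter.Eventually.of_forall fun z => (hf₀ z).trans (hfg z))).symm
    _ ≤ _ := ENNReal.ofReal_le_ofReal hbound

theorem lintegral_subsampled_pow_le {n : ℕ} (hn : 1 ≤ n) {q a : ℝ} (hq₀ : 0 ≤ q) (hq₁ : q ≤ 1)
    (ha : 0 ≤ a) (hna : n * a ^ 2 ≤ 1 / 32) :
    ∫⁻ z, ENNReal.ofReal ((1 + q * (Real.exp (a * z - a ^ 2 / 2) - 1)) ^ n) ∂gaussianReal 0 1 ≤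
      ENNReal.ofReal (Real.exp (subsampledConst * (n ^ 2 * q ^ 2 * a ^ 2))) := by
  have hpos := one_add_mul_exp_sub_one_pos hq₀ hq₁
  refine lintegral_le_exp_of_le_remainder hn hq₀ hq₁ ha hna n
    (fun z => pow_nonneg (hpos _).le n) fun z => one_add_pow_le_add_sq ?_ ?_ ?_ n
  · linarith [hpos (a * z - a ^ 2 / 2)]
  · linarith [mul_nonneg hq₀ (sub_nonneg.2 (Real.one_le_exp (abs_nonneg (a * z - a ^ 2 / 2))))]
  · exact one_add_mul_exp_sub_one_mono hq₀ (le_abs_self _)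

theorem lintegral_subsampled_inv_pow_le {n : ℕ} (hn : 1 ≤ n) {q a : ℝ} (hq₀ : 0 ≤ q) (hq₁ : q ≤ 1)
    (ha : 0 ≤ a) (hna : n * a ^ 2 ≤ 1 / 32) :
    ∫⁻ z, ENNReal.ofReal ((1 + q * (Real.exp (a * z - a ^ 2 / 2) - 1))⁻¹ ^ n) ∂gaussianReal 0 1 ≤
      ENNReal.ofReal (Real.exp (subsampledConst * (n ^ 2 * q ^ 2 * a ^ 2))) := by
  have hpos := one_add_mul_exp_sub_one_pos hq₀ hq₁
  refine lintegral_le_exp_of_le_remainder hn hq₀ hq₁ ha hna (-n)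
    (fun z => pow_nonneg (inv_nonneg.2 (hpos _).le) n) fun z => ?_
  rw [neg_mul, ← sub_eq_add_neg]
  refine inv_one_add_pow_le_add_sq ?_ ?_ ?_ n
  · linarith [hpos (a * z - a ^ 2 / 2)]
  · linarith [mul_nonneg hq₀ (sub_nonneg.2 (Real.one_le_exp (abs_nonneg (a * z - a ^ 2 / 2))))]
  · exact (inv_one_add_mul_exp_sub_one_le hq₀ hq₁ _).trans
      (one_add_mul_exp_sub_one_mono hq₀ (neg_le_abs _))

/-! ### Translates of the standard Gaussian law and reduction to one dimension. -/

theorem gaussianReal_eq_withDensity_exp (a : ℝ) :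
    gaussianReal a 1 = (gaussianReal 0 1).withDensity
      fun z => ENNReal.ofReal (Real.exp (a * z - a ^ 2 / 2)) := by
  rw [gaussianReal_of_var_ne_zero _ one_ne_zero, gaussianReal_of_var_ne_zero _ one_ne_zero,
    ← withDensity_mul _ (measurable_gaussianPDF _ _) (by fun_prop)]
  congr 1
  ext z
  simp only [gaussianPDF_def, Pi.mul_apply, gaussianPDFReal_def]
  rw [← ENNReal.ofReal_mul (by positivity), mul_assoc _ (Real.exp _) (Real.exp _), ← Real.exp_add]
  congr 3
  simp
  ring

theorem pi_withDensity {ι : Type*} [Fintype ι] {E : ι → Type*} [∀ i, MeasurableSpace (E i)]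
    (μ : (i : ι) → Measure (E i)) [∀ i, IsProbabilityMeasure (μ i)] {f : (i : ι) → E i → ℝ≥0∞}
    (hf : ∀ i, Measurable (f i)) [∀ i, SigmaFinite ((μ i).withDensity (f i))] :
    (Measure.pi μ).withDensity (fun x => ∏ i, f i (x i)) =
      Measure.pi fun i => (μ i).withDensity (f i) := by
  symm
  refine Measure.pi_eq fun s hs => ?_
  rw [withDensity_apply _ (MeasurableSet.univ_pi hs), ← lintegral_indicator (.univ_pi hs)]
  have e : ∀ x, (Set.univ.pi s).indicator (fun x => ∏ i, f i (x i)) x =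
      ∏ i, (s i).indicator (f i) (x i) := by
    intro x
    by_cases hx : x ∈ Set.univ.pi s
    · rw [Set.indicator_of_mem hx]
      exact Finset.prod_congr rfl fun i _ => (Set.indicator_of_mem (hx i trivial) _).symm
    · rw [Set.indicator_of_notMem hx]
      simp only [Set.mem_pi, Set.mem_univ, true_implies, not_forall] at hx
      obtain ⟨i, hi⟩ := hx
      exact (Finset.prod_eq_zero (Finset.mem_univ i) (Set.indicator_of_notMem hi _)).symm
  have hm : ∀ i, Measurable ((s i).indicator (f i)) := fun i => (hf i).indicator (hs i)
  simp_rw [e]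
  have hind := iIndepFun_pi (μ := μ) (X := fun i => (s i).indicator (f i))
    fun i => (hm i).aemeasurable
  rw [lintegral_prod_eq_prod_lintegral_of_indepFun Finset.univ _ hind
    fun i => (hm i).comp (measurable_pi_apply i)]
  refine Finset.prod_congr rfl fun i _ => ?_
  rw [(measurePreserving_eval μ i).lintegral_comp (hm i), lintegral_indicator (hs i),
    withDensity_apply _ (hs i)]

/-- The Cameron–Martin formula for the standard Gaussian law. -/
theorem stdGaussian_map_add_eq_withDensity {d : ℕ} (v : Vec d) :
    (stdGaussian (Vec d)).map (· + v) = (stdGaussian (Vec d)).withDensity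
      fun z => ENNReal.ofReal (Real.exp (inner ℝ v z - ‖v‖ ^ 2 / 2)) := by
  have h1 : (Measure.pi fun _ : Fin d => gaussianReal 0 1).map (fun x i => x i + v i) =
      (Measure.pi fun _ : Fin d => gaussianReal 0 1).withDensity
        (fun x => ∏ i, ENNReal.ofReal (Real.exp (v i * x i - v i ^ 2 / 2))) := by
    have : ∀ i, IsProbabilityMeasure ((gaussianReal 0 1).withDensity
        fun z => ENNReal.ofReal (Real.exp (v i * z - v i ^ 2 / 2))) := fun i => by
      rw [← gaussianReal_eq_withDensity_exp]; infer_instance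
    rw [pi_withDensity (fun _ : Fin d => gaussianReal 0 1)
      (f := fun i z => ENNReal.ofReal (Real.exp (v i * z - v i ^ 2 / 2))) (fun i => by fun_prop)]
    simp_rw [← gaussianReal_eq_withDensity_exp]
    rw [Measure.pi_map_pi (f := fun i x => x + v i) (fun i => by fun_prop)]
    simp [gaussianReal_map_add_const]
  rw [← map_pi_eq_stdGaussian, Measure.map_map (by fun_prop) (by fun_prop)]
  have h2 : (fun x : Vec d => x + v) ∘ WithLp.toLp 2 =
      WithLp.toLp 2 ∘ fun (x : Fin d → ℝ) i => x i + v i := by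
    ext x i
    simp
  rw [h2, ← Measure.map_map (by fun_prop) (by fun_prop), h1]
  ext s hs
  rw [Measure.map_apply (by fun_prop) hs, withDensity_apply _ hs,
    withDensity_apply _ ((by fun_prop : Measurable (WithLp.toLp 2 : (Fin d → ℝ) → Vec d)) hs),
    setLIntegral_map hs (by fun_prop) (by fun_prop)]
  refine lintegral_congr fun x => ?_
  rw [← ENNReal.ofReal_prod_of_nonneg fun i _ => (Real.exp_pos _).le, ← Real.exp_sum,
    EuclideanSpace.real_norm_sq_eq, Finset.sum_sub_distrib, Finset.sum_div]
  simp [PiLp.inner_apply, mul_comm]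

/-- The Cameron–Martin density depends on `z` only through `inner ℝ v z`, so this reduces moments in
dimension `d` to the real line and makes the constants independent of `d`. -/
theorem stdGaussian_map_inner {d : ℕ} (v : Vec d) :
    (stdGaussian (Vec d)).map (fun z => inner ℝ v z) = (gaussianReal 0 1).map (‖v‖ * ·) := by
  have h := IsGaussian.map_eq_gaussianReal (μ := stdGaussian (Vec d)) (innerSL ℝ v)
  rw [integral_strongDual_stdGaussian, variance_dual_stdGaussian,
    Real.toNNReal_of_nonneg (sq_nonneg _)] at h
  rw [gaussianReal_map_const_mul]
  simp only [innerSL_apply_norm, mul_zero, mul_one] at h ⊢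
  convert h using 2
  ext
  simp

theorem lintegral_comp_inner_stdGaussian {d : ℕ} (v : Vec d) {f : ℝ → ℝ≥0∞} (hf : Measurable f) :
    ∫⁻ z, f (inner ℝ v z) ∂stdGaussian (Vec d) = ∫⁻ z, f (‖v‖ * z) ∂gaussianReal 0 1 := by
  rw [← lintegral_map hf (by fun_prop : Measurable fun z : Vec d => inner ℝ v z),
    stdGaussian_map_inner, lintegral_map hf (by fun_prop)]

/-! ### Hölder domination between the Gaussian and the subsampled Gaussian. -/

namespace HolderDom

variable {Y : Type*} [MeasurableSpace Y]

theorem withDensity_left {α β : ℝ} (hαβ : α.HolderConjugate β) {Q : Measure Y} {F : Y → ℝ≥0∞}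
    (hF : Measurable F) {A : ℝ≥0∞} (hA : ∫⁻ y, F y ^ α ∂Q ≤ A ^ α) :
    HolderDom β A (Q.withDensity F) Q := by
  intro h hh
  rw [lintegral_withDensity_eq_lintegral_mul _ hF hh]
  refine (ENNReal.lintegral_mul_le_Lp_mul_Lq Q hαβ hF.aemeasurable hh.aemeasurable).trans ?_
  rw [one_div, one_div]
  gcongr
  rwa [ENNReal.rpow_inv_le_iff hαβ.pos]

/-- Write `h = F ^ (-β⁻¹) * (F ^ β⁻¹ * h)` and apply Hölder: the first factor contributes `F` to the
power `-α / β = 1 - α`, and the second rebuilds the density `F`. -/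
theorem withDensity_right {α β : ℝ} (hαβ : α.HolderConjugate β) {Q : Measure Y} {F : Y → ℝ≥0∞}
    (hF : Measurable F) (hF₀ : ∀ y, F y ≠ 0) (hF₁ : ∀ y, F y ≠ ∞) {A : ℝ≥0∞}
    (hA : ∫⁻ y, F y ^ (1 - α) ∂Q ≤ A ^ α) :
    HolderDom β A Q (Q.withDensity F) := by
  intro h hh
  rw [lintegral_withDensity_eq_lintegral_mul _ hF (by fun_prop)]
  have hβ := hαβ.symm.pos
  have e : ∀ y, h y = F y ^ (-β⁻¹) * (F y ^ β⁻¹ * h y) := fun y => by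
    rw [← mul_assoc, ← ENNReal.rpow_add _ _ (hF₀ y) (hF₁ y)]
    simp
  calc ∫⁻ y, h y ∂Q = ∫⁻ y, ((fun y => F y ^ (-β⁻¹)) * fun y => F y ^ β⁻¹ * h y) y ∂Q :=
        lintegral_congr e
    _ ≤ (∫⁻ y, (F y ^ (-β⁻¹)) ^ α ∂Q) ^ (1 / α) * (∫⁻ y, (F y ^ β⁻¹ * h y) ^ β ∂Q) ^ (1 / β) :=
        ENNReal.lintegral_mul_le_Lp_mul_Lq Q hαβ (by fun_prop) (by fun_prop)
    _ ≤ A * (∫⁻ y, (F * fun y => h y ^ β) y ∂Q) ^ β⁻¹ := by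
        rw [one_div, one_div]
        gcongr ?_ * ?_
        · rw [ENNReal.rpow_inv_le_iff hαβ.pos]
          refine le_trans (le_of_eq (lintegral_congr fun y => ?_)) hA
          rw [← ENNReal.rpow_mul]
          congr 1
          have := hαβ.symm.one_sub_inv
          have h2 := hαβ.pos.ne'
          rw [show β⁻¹ = 1 - α⁻¹ by linarith]
          field_simp
          ring
        · refine le_of_eq (congrArg (· ^ β⁻¹) (lintegral_congr fun y => ?_))
          rw [ENNReal.mul_rpow_of_nonneg _ _ hβ.le, ← ENNReal.rpow_mul, inv_mul_cancel₀ hβ.ne',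
            ENNReal.rpow_one]
          rfl

end HolderDom

/-- The law `(1 - q) N(0, I) + q N(v, I)`. -/
noncomputable def subsampledGaussian {d : ℕ} (q : ℝ) (v : Vec d) : Measure (Vec d) :=
  ENNReal.ofReal (1 - q) • stdGaussian (Vec d) +
    ENNReal.ofReal q • (stdGaussian (Vec d)).map (· + v)

theorem subsampledGaussian_eq_withDensity {d : ℕ} {q : ℝ} (hq₀ : 0 ≤ q) (hq₁ : q ≤ 1) (v : Vec d) :
    subsampledGaussian q v = (stdGaussian (Vec d)).withDensity fun z =>
      ENNReal.ofReal (1 + q * (Real.exp (inner ℝ v z - ‖v‖ ^ 2 / 2) - 1)) := by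
  rw [subsampledGaussian, stdGaussian_map_add_eq_withDensity,
    ← withDensity_smul _ (by fun_prop), ← withDensity_const, ← withDensity_add_left (by fun_prop)]
  congr 1
  ext z
  simp only [Pi.add_apply, Pi.smul_apply, smul_eq_mul]
  rw [← ENNReal.ofReal_mul hq₀, ← ENNReal.ofReal_add (by linarith) (by positivity)]
  congr 1
  ring

/-- The bound on the Hölder constant of order `n / (n - 1)` for one step with sampling
probability `q` and normalized sensitivity `a`. -/
noncomputable def stepBound (n : ℕ) (q a : ℝ) : ℝ≥0∞ :=
  ENNReal.ofReal (Real.exp (subsampledConst * (n * q ^ 2 * a ^ 2)))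

theorem stepBound_rpow (n : ℕ) (q a : ℝ) :
    stepBound n q a ^ (n : ℝ) =
      ENNReal.ofReal (Real.exp (subsampledConst * (n ^ 2 * q ^ 2 * a ^ 2))) := by
  rw [stepBound, ENNReal.rpow_natCast, ← ENNReal.ofReal_pow (Real.exp_pos _).le,
    ← Real.exp_nat_mul]
  ring_nf

theorem holderConjugate_succ {n : ℕ} (hn : 1 ≤ n) :
    ((n + 1 : ℕ) : ℝ).HolderConjugate ((n + 1) / n) := by
  have hn' : (0 : ℝ) < n := by exact_mod_cast hn
  rw [Real.holderConjugate_iff]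
  push_cast
  exact ⟨by linarith, by field_simp; ring⟩

section

variable {d n : ℕ} {q a : ℝ} {v : Vec d}

theorem holderDom_subsampledGaussian_left (hn : 1 ≤ n) (hq₀ : 0 ≤ q) (hq₁ : q ≤ 1) (hv : ‖v‖ ≤ a)
    (hna : (n + 1) * a ^ 2 ≤ 1 / 32) :
    HolderDom ((n + 1) / n) (stepBound (n + 1) q a) (subsampledGaussian q v)
      (stdGaussian (Vec d)) := by
  have hpos := one_add_mul_exp_sub_one_pos hq₀ hq₁
  have hav : ‖v‖ ^ 2 ≤ a ^ 2 := by gcongr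
  have hC := subsampledConst_pos
  rw [subsampledGaussian_eq_withDensity hq₀ hq₁]
  refine HolderDom.withDensity_left (holderConjugate_succ hn) (by fun_prop) ?_
  rw [stepBound_rpow]
  simp_rw [ENNReal.rpow_natCast, ← ENNReal.ofReal_pow (hpos _).le]
  rw [lintegral_comp_inner_stdGaussian v (f := fun x => ENNReal.ofReal
    ((1 + q * (Real.exp (x - ‖v‖ ^ 2 / 2) - 1)) ^ (n + 1))) (by fun_prop)]
  refine (lintegral_subsampled_pow_le (by lia) hq₀ hq₁ (norm_nonneg v) ?_).trans ?_
  · push_cast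
    nlinarith
  · gcongr

theorem holderDom_subsampledGaussian_right (hn : 1 ≤ n) (hq₀ : 0 ≤ q) (hq₁ : q ≤ 1) (hv : ‖v‖ ≤ a)
    (hna : (n + 1) * a ^ 2 ≤ 1 / 32) :
    HolderDom ((n + 1) / n) (stepBound (n + 1) q a) (stdGaussian (Vec d))
      (subsampledGaussian q v) := by
  have hpos := one_add_mul_exp_sub_one_pos hq₀ hq₁
  have hav : ‖v‖ ^ 2 ≤ a ^ 2 := by gcongr
  have hC := subsampledConst_pos
  rw [subsampledGaussian_eq_withDensity hq₀ hq₁]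
  refine HolderDom.withDensity_right (holderConjugate_succ hn) (by fun_prop)
    (fun z => (ENNReal.ofReal_pos.2 (hpos _)).ne') (fun z => ENNReal.ofReal_ne_top) ?_
  rw [stepBound_rpow]
  -- At order `α = n + 1` the exponent `1 - α` is `-n`, so the reciprocal moment needed has order
  -- `n`, one less than in the other direction.
  have e : ∀ x, ENNReal.ofReal (1 + q * (Real.exp x - 1)) ^ (1 - ((n + 1 : ℕ) : ℝ)) =
      ENNReal.ofReal ((1 + q * (Real.exp x - 1))⁻¹ ^ n) := fun x => by
    rw [show 1 - ((n + 1 : ℕ) : ℝ) = -(n : ℝ) by push_cast; ring, ENNReal.rpow_neg,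
      ENNReal.rpow_natCast, ENNReal.ofReal_pow (inv_nonneg.2 (hpos x).le),
      ENNReal.ofReal_inv_of_pos (hpos x), ENNReal.inv_pow]
  simp_rw [e]
  rw [lintegral_comp_inner_stdGaussian v (f := fun x => ENNReal.ofReal
    ((1 + q * (Real.exp (x - ‖v‖ ^ 2 / 2) - 1))⁻¹ ^ n)) (by fun_prop)]
  refine (lintegral_subsampled_inv_pow_le hn hq₀ hq₁ (norm_nonneg v) ?_).trans ?_
  · nlinarith [sq_nonneg ‖v‖, sq_nonneg a, (n.cast_nonneg : (0 : ℝ) ≤ n)]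
  · gcongr
    simp

end

/-! ### One noisy step under the change of one record. -/

theorem norm_clip_le {d : ℕ} {Ω : ℝ} (hΩ : 0 < Ω) (g : Vec d) : ‖clip Ω g‖ ≤ Ω := by
  have h1 : 0 < max 1 (‖g‖ / Ω) := lt_max_of_lt_left one_pos
  rw [clip, norm_smul, norm_inv, Real.norm_of_nonneg h1.le, inv_mul_le_iff₀ h1]
  calc ‖g‖ = ‖g‖ / Ω * Ω := by field_simp
    _ ≤ max 1 (‖g‖ / Ω) * Ω := by gcongr; exact le_max_right _ _

/-- The law of the next parameter after a noisy step from `θ` in which the gradient on the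
batch is `g`. -/
noncomputable def stepLaw {d : ℕ} (σ Ω η : ℝ) (θ g : Vec d) : Measure (Vec d) :=
  (stdGaussian (Vec d)).map fun z => θ - η • (clip Ω g + (σ * Ω) • z)

instance {d : ℕ} (σ Ω η : ℝ) (θ g : Vec d) : IsProbabilityMeasure (stepLaw σ Ω η θ g) :=
  Measure.isProbabilityMeasure_map (by fun_prop)

/-- The law of the next parameter when the gradient on the batch is `g'` with probability `q`
and `g` otherwise. -/
noncomputable def mixedStepLaw {d : ℕ} (q σ Ω η : ℝ) (θ g g' : Vec d) : Measure (Vec d) :=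
  ENNReal.ofReal (1 - q) • stepLaw σ Ω η θ g + ENNReal.ofReal q • stepLaw σ Ω η θ g'

theorem mixedStepLaw_self {d : ℕ} {q : ℝ} (hq₀ : 0 ≤ q) (hq₁ : q ≤ 1) (σ Ω η : ℝ) (θ g : Vec d) :
    mixedStepLaw q σ Ω η θ g g = stepLaw σ Ω η θ g := by
  rw [mixedStepLaw, ← add_smul, ← ENNReal.ofReal_add (by linarith) hq₀]
  simp

/-- Replacing one clipped gradient by another amounts to shifting the standard noise before a fixed
affine map. Domination passes to images, so the map need not be injective and `η = 0` is allowed. -/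
theorem mixedStepLaw_eq_map {d : ℕ} {q σ Ω : ℝ} (hσ : 0 < σ) (hΩ : 0 < Ω) (η : ℝ)
    (θ g g' : Vec d) :
    mixedStepLaw q σ Ω η θ g g' =
      (subsampledGaussian q ((σ * Ω)⁻¹ • (clip Ω g' - clip Ω g))).map
        fun z => θ - η • (clip Ω g + (σ * Ω) • z) := by
  have h0 : σ * Ω ≠ 0 := by positivity
  rw [subsampledGaussian, Measure.map_add _ _ (by fun_prop), Measure.map_smul, Measure.map_smul,
    Measure.map_map (by fun_prop) (by fun_prop), mixedStepLaw, stepLaw, stepLaw]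
  congr 3
  ext z : 1
  simp only [Function.comp, smul_add, smul_inv_smul₀ h0]
  congr 1
  rw [← smul_add, ← smul_add, ← smul_add]
  congr 1
  abel

/-- The batch gradient is clipped as a whole, so one record may move it anywhere in the ball of
radius `Ω`, whence the diameter `2 * Ω`. Nothing about the loss or the optimal permutation enters.
-/
theorem norm_clip_sub_clip_le {d : ℕ} {σ Ω : ℝ} (hσ : 0 < σ) (hΩ : 0 < Ω) (g g' : Vec d) :
    ‖(σ * Ω)⁻¹ • (clip Ω g' - clip Ω g)‖ ≤ 2 / σ := by
  have h0 : 0 < σ * Ω := by positivity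
  rw [norm_smul, norm_inv, Real.norm_of_nonneg h0.le, inv_mul_le_iff₀ h0]
  calc ‖clip Ω g' - clip Ω g‖ ≤ ‖clip Ω g'‖ + ‖clip Ω g‖ := norm_sub_le _ _
    _ ≤ Ω + Ω := add_le_add (norm_clip_le hΩ _) (norm_clip_le hΩ _)
    _ = σ * Ω * (2 / σ) := by field_simp; ring

/-- The probability that the batch, restricted to the identifiers different from a given one,
is formed by `J`. -/
noncomputable def batchWeight (n : ℕ) (q : ℝ) (J : Finset (Fin n)) : ℝ≥0∞ :=
  ENNReal.ofReal (q ^ J.card * (1 - q) ^ (n - 1 - J.card))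

section

variable {n d : ℕ} {X : Type} {q : ℝ}

theorem sum_batchWeight (hq₀ : 0 ≤ q) (hq₁ : q ≤ 1) (i : Fin n) :
    ∑ J ∈ (Finset.univ.erase i).powerset, batchWeight n q J = 1 := by
  have h1 : 0 ≤ 1 - q := by linarith
  simp only [batchWeight]
  rw [← ENNReal.ofReal_sum_of_nonneg fun J _ => by positivity]
  have h := Finset.sum_pow_mul_eq_add_pow q (1 - q) (Finset.univ.erase i)
  simp only [Finset.card_erase_of_mem (Finset.mem_univ i), Finset.card_univ, Fintype.card_fin] at h
  rw [h]
  simp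

/-- Subsets of identifiers are paired as `J` and `insert i J` with `i ∉ J`: the coins of the other
identifiers are fixed first, and that of `i` is tossed last. -/
theorem noisyStep_eq_sum_mixedStepLaw (hq₀ : 0 ≤ q) (hq₁ : q ≤ 1) (σ Ω η : ℝ)
    (grad : Dataset n X → Vec d → Vec d) (D : Dataset n X) (θ : Vec d) (i : Fin n) :
    noisyStep q σ Ω η grad D θ = ∑ J ∈ (Finset.univ.erase i).powerset, batchWeight n q J •
      mixedStepLaw q σ Ω η θ (grad (D.batch J) θ) (grad (D.batch (insert i J)) θ) := by
  have h1 : 0 ≤ 1 - q := by linarith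
  have hu : (Finset.univ : Finset (Finset (Fin n))) =
      (insert i (Finset.univ.erase i)).powerset := by
    rw [Finset.insert_erase (Finset.mem_univ i), Finset.powerset_univ]
  rw [noisyStep, hu, Finset.sum_powerset_insert (Finset.notMem_erase i _),
    ← Finset.sum_add_distrib]
  refine Finset.sum_congr rfl fun J hJ => ?_
  rw [Finset.mem_powerset] at hJ
  have hiJ : i ∉ J := fun h => Finset.notMem_erase i _ (hJ h)
  have hcard : J.card ≤ n - 1 := by
    simpa using Finset.card_le_card hJ
  have hn : 0 < n := i.pos
  rw [mixedStepLaw, smul_add, smul_smul, smul_smul, batchWeight,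
    ← ENNReal.ofReal_mul (by positivity), ← ENNReal.ofReal_mul (by positivity),
    Finset.card_insert_of_notMem hiJ, stepLaw, stepLaw]
  congr 3
  · rw [show n - J.card = n - 1 - J.card + 1 by lia]
    ring
  · rw [show n - (J.card + 1) = n - 1 - J.card by lia]
    ring

theorem batch_update_of_notMem (D : Dataset n X) {i : Fin n} {J : Finset (Fin n)} (hJ : i ∉ J)
    (r : Option X) : Dataset.batch (Function.update D i r) J = D.batch J := by
  ext1 k
  by_cases hk : k = i
  · simp [Dataset.batch, hk, hJ]
  · simp [Dataset.batch, hk]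

theorem batch_insert_of_eq_none (D : Dataset n X) {i : Fin n} (hi : D i = none)
    (J : Finset (Fin n)) : D.batch (insert i J) = D.batch J := by
  ext1 k
  by_cases hk : k = i
  · simp [Dataset.batch, hk, hi]
  · simp [Dataset.batch, hk]

variable {σ Ω η β : ℝ} {A : ℝ≥0∞} {D : Dataset n X} {i : Fin n}

theorem holderDom_noisyStep_update (hβ : 1 ≤ β) (hq₀ : 0 ≤ q) (hq₁ : q ≤ 1) {θ : Vec d}
    (h : ∀ g g', HolderDom β A (stepLaw σ Ω η θ g) (mixedStepLaw q σ Ω η θ g g'))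
    (hi : D i = none) (r : X) (grad : Dataset n X → Vec d → Vec d) :
    HolderDom β A (noisyStep q σ Ω η grad D θ)
      (noisyStep q σ Ω η grad (Function.update D i (some r)) θ) := by
  rw [noisyStep_eq_sum_mixedStepLaw hq₀ hq₁ _ _ _ _ _ _ i,
    noisyStep_eq_sum_mixedStepLaw hq₀ hq₁ _ _ _ _ _ _ i]
  refine HolderDom.sum_smul hβ (sum_batchWeight hq₀ hq₁ i) fun J hJ => ?_
  have hiJ : i ∉ J := fun h => Finset.notMem_erase i _ (Finset.mem_powerset.1 hJ h)
  -- Without record `i` the last coin has no effect, so this side is an unmixed step. The two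
  -- datasets give the same batch on `J`, so the mixture on the other side contains that same step.
  rw [batch_insert_of_eq_none D hi, mixedStepLaw_self hq₀ hq₁, batch_update_of_notMem D hiJ]
  exact h _ _

theorem holderDom_update_noisyStep (hβ : 1 ≤ β) (hq₀ : 0 ≤ q) (hq₁ : q ≤ 1) {θ : Vec d}
    (h : ∀ g g', HolderDom β A (mixedStepLaw q σ Ω η θ g g') (stepLaw σ Ω η θ g))
    (hi : D i = none) (r : X) (grad : Dataset n X → Vec d → Vec d) :
    HolderDom β A (noisyStep q σ Ω η grad (Function.update D i (some r)) θ)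
      (noisyStep q σ Ω η grad D θ) := by
  rw [noisyStep_eq_sum_mixedStepLaw hq₀ hq₁ _ _ _ _ _ _ i,
    noisyStep_eq_sum_mixedStepLaw hq₀ hq₁ _ _ _ _ _ _ i]
  refine HolderDom.sum_smul hβ (sum_batchWeight hq₀ hq₁ i) fun J hJ => ?_
  have hiJ : i ∉ J := fun h => Finset.notMem_erase i _ (Finset.mem_powerset.1 hJ h)
  rw [batch_insert_of_eq_none D hi, mixedStepLaw_self hq₀ hq₁, batch_update_of_notMem D hiJ]
  exact h _ _

theorem isProbabilityMeasure_noisyStep (hq₀ : 0 ≤ q) (hq₁ : q ≤ 1) (σ Ω η : ℝ)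
    (grad : Dataset n X → Vec d → Vec d) (D : Dataset n X) (θ : Vec d) :
    IsProbabilityMeasure (noisyStep q σ Ω η grad D θ) := by
  have h1 : 0 ≤ 1 - q := by linarith
  constructor
  have : ∀ J : Finset (Fin n), (stdGaussian (Vec d)).map
      (fun z => θ - η • (clip Ω (grad (D.batch J) θ) + (σ * Ω) • z)) Set.univ = 1 := fun J =>
    (inferInstance : IsProbabilityMeasure (stepLaw σ Ω η θ (grad (D.batch J) θ))).measure_univ
  simp only [noisyStep, Measure.coe_finsetSum, Finset.sum_apply, Measure.smul_apply, this,
    smul_eq_mul, mul_one]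
  rw [← ENNReal.ofReal_sum_of_nonneg fun J _ => by positivity]
  simp [Fin.sum_pow_mul_eq_add_pow]

end

/-- A single step and its perturbation by one sampled record dominate each other, in the sense of
the moments of their likelihood ratio. -/
theorem holderDom_mixedStepLaw {d n : ℕ} (hn : 1 ≤ n) {q σ Ω : ℝ} (hq₀ : 0 ≤ q) (hq₁ : q ≤ 1)
    (hσ : 0 < σ) (hΩ : 0 < Ω) (hna : (n + 1) * (2 / σ) ^ 2 ≤ 1 / 32) (η : ℝ) (θ g g' : Vec d) :
    HolderDom ((n + 1) / n) (stepBound (n + 1) q (2 / σ)) (stepLaw σ Ω η θ g)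
        (mixedStepLaw q σ Ω η θ g g') ∧
      HolderDom ((n + 1) / n) (stepBound (n + 1) q (2 / σ)) (mixedStepLaw q σ Ω η θ g g')
        (stepLaw σ Ω η θ g) := by
  rw [mixedStepLaw_eq_map hσ hΩ, stepLaw]
  have hv := norm_clip_sub_clip_le hσ hΩ g g'
  exact ⟨(holderDom_subsampledGaussian_right hn hq₀ hq₁ hv hna).map (by fun_prop),
    (holderDom_subsampledGaussian_left hn hq₀ hq₁ hv hna).map (by fun_prop)⟩

/-- The mixture contains the unmixed law with weight `1 - q`. No noise is required, so `σ` is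
arbitrary. -/
theorem holderDom_one_mixedStepLaw {d : ℕ} {q : ℝ} (hq₁ : q < 1) (σ Ω η : ℝ)
    (θ g g' : Vec d) :
    HolderDom 1 (ENNReal.ofReal (1 - q)⁻¹) (stepLaw σ Ω η θ g)
      (mixedStepLaw q σ Ω η θ g g') := by
  intro h _
  have h1 : 0 < 1 - q := by linarith
  simp only [mixedStepLaw, ENNReal.rpow_one, inv_one, lintegral_add_measure,
    lintegral_smul_measure, smul_eq_mul]
  rw [mul_add, ← mul_assoc, ← ENNReal.ofReal_mul (by positivity), inv_mul_cancel₀ h1.ne']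
  simp

/-! ### Measurability of kernels, and composition along a trajectory. -/

section Measurability

variable {Γ Y Z : Type*} [MeasurableSpace Γ] [MeasurableSpace Y] [MeasurableSpace Z]

theorem measurable_map_of_uncurry {κ : Γ → Measure Y} (hκ : Measurable κ)
    [∀ c, IsProbabilityMeasure (κ c)] {f : Γ → Y → Z} (hf : Measurable (Function.uncurry f)) :
    Measurable fun c => (κ c).map (f c) := by
  let K : Kernel Γ Y := ⟨κ, hκ⟩
  have : IsMarkovKernel K := ⟨fun c => inferInstanceAs (IsProbabilityMeasure (κ c))⟩
  refine Measure.measurable_of_measurable_coe _ fun s hs => ?_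
  have e : ∀ c, (κ c).map (f c) s = K c (Prod.mk c ⁻¹' (Function.uncurry f ⁻¹' s)) := fun c =>
    Measure.map_apply (hf.comp measurable_prodMk_left) hs
  simp_rw [e]
  exact Kernel.measurable_kernel_prodMk_left (hf hs)

theorem measurable_bind_of_uncurry {κ : Γ → Measure Y} (hκ : Measurable κ)
    [∀ c, IsProbabilityMeasure (κ c)] {g : Γ → Y → Measure Z}
    (hg : Measurable (Function.uncurry g)) : Measurable fun c => (κ c).bind (g c) := by
  let K : Kernel Γ Y := ⟨κ, hκ⟩
  have : IsMarkovKernel K := ⟨fun c => inferInstanceAs (IsProbabilityMeasure (κ c))⟩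
  refine Measure.measurable_of_measurable_coe _ fun s hs => ?_
  have e : ∀ c, (κ c).bind (g c) s = ∫⁻ y, Function.uncurry g (c, y) s ∂K c := fun c =>
    Measure.bind_apply hs (hg.comp measurable_prodMk_left).aemeasurable
  simp_rw [e]
  exact Measurable.lintegral_kernel_prod_right' (κ := K)
    (f := fun p => Function.uncurry g p s) ((Measure.measurable_coe hs).comp hg)

theorem isProbabilityMeasure_bind_of_measurable {P : Measure Y} [IsProbabilityMeasure P]
    {K : Y → Measure Z} (hK : Measurable K) [∀ y, IsProbabilityMeasure (K y)] :
    IsProbabilityMeasure (P.bind K) := by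
  constructor
  rw [Measure.bind_apply MeasurableSet.univ hK.aemeasurable]
  simp

theorem measurable_clip {d : ℕ} (Ω : ℝ) : Measurable (clip Ω : Vec d → Vec d) := by
  unfold clip
  fun_prop

theorem measurable_noisyStep {n d : ℕ} {X : Type} (q σ Ω η : ℝ)
    {grad : Γ → Dataset n X → Vec d → Vec d}
    (hgrad : ∀ B, Measurable fun p : Γ × Vec d => grad p.1 B p.2) (D : Dataset n X) :
    Measurable fun p : Γ × Vec d => noisyStep q σ Ω η (grad p.1) D p.2 := by
  refine Measure.measurable_of_measurable_coe _ fun s hs => ?_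
  simp only [noisyStep, Measure.coe_finsetSum, Finset.sum_apply, Measure.smul_apply, smul_eq_mul]
  refine Finset.measurable_sum _ fun J _ => Measurable.const_mul ?_ _
  refine (Measure.measurable_coe hs).comp (measurable_map_of_uncurry
    (κ := fun _ : Γ × Vec d => stdGaussian (Vec d)) measurable_const
    (f := fun p z => p.2 - η • (clip Ω (grad p.1 (D.batch J) p.2) + (σ * Ω) • z)) ?_)
  have h : Measurable fun x : (Γ × Vec d) × Vec d =>
      clip Ω (grad x.1.1 (D.batch J) x.1.2) :=
    (measurable_clip Ω).comp ((hgrad _).comp measurable_fst)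
  unfold Function.uncurry
  fun_prop

theorem measurable_snoc {d T : ℕ} :
    Measurable fun p : (Fin (T + 1) → Vec d) × Vec d =>
      (Fin.snoc p.1 p.2 : Fin (T + 2) → Vec d) := by
  refine measurable_pi_iff.2 fun i => ?_
  induction i using Fin.lastCases with
  | last => simpa using measurable_snd
  | cast i =>
    simp only [Fin.snoc_castSucc]
    fun_prop

variable {d : ℕ} {init : Measure (Vec d)} {step : ℕ → Vec d → Measure (Vec d)}

theorem measurable_snoc_step (hstep : ∀ t, Measurable (step t))
    (hprob : ∀ t θ, IsProbabilityMeasure (step t θ)) (T : ℕ) :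
    Measurable fun h : Fin (T + 1) → Vec d =>
      (step T (h (Fin.last T))).map fun θ => (Fin.snoc h θ : Fin (T + 2) → Vec d) :=
  measurable_map_of_uncurry (κ := fun h : Fin (T + 1) → Vec d => step T (h (Fin.last T)))
    ((hstep T).comp (measurable_pi_apply (Fin.last T)))
    (f := fun h θ => (Fin.snoc h θ : Fin (T + 2) → Vec d)) measurable_snoc

theorem isProbabilityMeasure_snoc_step (hprob : ∀ t θ, IsProbabilityMeasure (step t θ)) (T : ℕ)
    (h : Fin (T + 1) → Vec d) : IsProbabilityMeasure
      ((step T (h (Fin.last T))).map fun θ => (Fin.snoc h θ : Fin (T + 2) → Vec d)) :=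
  Measure.isProbabilityMeasure_map (measurable_snoc.comp measurable_prodMk_left).aemeasurable

theorem isProbabilityMeasure_trajectory [IsProbabilityMeasure init]
    (hstep : ∀ t, Measurable (step t)) (hprob : ∀ t θ, IsProbabilityMeasure (step t θ)) (T : ℕ) :
    IsProbabilityMeasure (trajectory init step T) := by
  induction T with
  | zero => exact Measure.isProbabilityMeasure_map (by fun_prop)
  | succ T ih =>
    have := isProbabilityMeasure_snoc_step hprob T
    exact isProbabilityMeasure_bind_of_measurable (measurable_snoc_step hstep hprob T)

theorem measurable_trajectory [IsProbabilityMeasure init] {step : Γ → ℕ → Vec d → Measure (Vec d)}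
    (hstep : ∀ t, Measurable fun p : Γ × Vec d => step p.1 t p.2)
    (hprob : ∀ c t θ, IsProbabilityMeasure (step c t θ)) (T : ℕ) :
    Measurable fun c => trajectory init (step c) T := by
  induction T with
  | zero => exact measurable_const
  | succ T ih =>
    have : ∀ c, IsProbabilityMeasure (trajectory init (step c) T) := fun c =>
      isProbabilityMeasure_trajectory
        (fun t => (hstep t).comp (measurable_prodMk_left (x := c))) (hprob c) T
    have hlast : Measurable fun p : Γ × (Fin (T + 1) → Vec d) => (p.1, p.2 (Fin.last T)) := by
      fun_prop
    have hsnoc : Measurable fun x : (Γ × (Fin (T + 1) → Vec d)) × Vec d =>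
        (Fin.snoc x.1.2 x.2 : Fin (T + 2) → Vec d) :=
      measurable_snoc.comp ((measurable_snd.comp measurable_fst).prodMk measurable_snd)
    exact measurable_bind_of_uncurry ih (measurable_map_of_uncurry
      (κ := fun p : Γ × (Fin (T + 1) → Vec d) => step p.1 T (p.2 (Fin.last T)))
      ((hstep T).comp hlast) hsnoc)

/-- The common initial law costs the factor `1`, and each adaptive step costs `A`; uniformity in `θ`
is essential because the gradient is evaluated at a random past parameter. -/
theorem holderDom_trajectory [IsProbabilityMeasure init] {step' : ℕ → Vec d → Measure (Vec d)}
    {β : ℝ} (hβ : 1 ≤ β) {A : ℝ≥0∞} (hstep : ∀ t, Measurable (step t))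
    (hprob : ∀ t θ, IsProbabilityMeasure (step t θ)) (hstep' : ∀ t, Measurable (step' t))
    (hprob' : ∀ t θ, IsProbabilityMeasure (step' t θ))
    (h : ∀ t θ, HolderDom β A (step t θ) (step' t θ)) (T : ℕ) :
    HolderDom β (A ^ T) (trajectory init step T) (trajectory init step' T) := by
  induction T with
  | zero =>
    rw [pow_zero]
    exact (HolderDom.refl hβ init).map (by fun_prop)
  | succ T ih =>
    rw [pow_succ]
    exact ih.bind (zero_lt_one.trans_le hβ) (measurable_snoc_step hstep hprob T)
      (measurable_snoc_step hstep' hprob' T)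
      fun y => (h _ _).map (measurable_snoc.comp measurable_prodMk_left)

theorem measurable_gradient_with_param {α : Type*} [TopologicalSpace α] [MeasurableSpace α]
    [OpensMeasurableSpace α] {f : α → Vec d → ℝ} (hf : Continuous (Function.uncurry f)) :
    Measurable fun p : α × Vec d => gradient (f p.1) p.2 := by
  unfold gradient
  exact (InnerProductSpace.toDual ℝ (Vec d)).symm.continuous.measurable.comp
    (measurable_fderiv_with_param ℝ hf)

/-- An arbitrary choice function is harmless: it sees only the set `S p`, which takes finitely many
values, and on each of them the function is a fixed measurable gradient. -/
theorem measurable_gradient_choice {α ι : Type*} [TopologicalSpace α] [MeasurableSpace α]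
    [OpensMeasurableSpace α] [Finite ι] {f : ι → α → Vec d → ℝ}
    (hf : ∀ i, Continuous (Function.uncurry (f i))) {S : α × Vec d → Set ι} (hS : Measurable S)
    (choice : Set ι → ι) :
    Measurable fun p : α × Vec d => gradient (f (choice (S p)) p.1) p.2 := by
  have h : Measurable fun x : Set ι × (α × Vec d) => gradient (f (choice x.1) x.2.1) x.2.2 :=
    measurable_from_prod_countable_right fun s => measurable_gradient_with_param (hf (choice s))
  exact h.comp (hS.prodMk measurable_id)

end Measurability

/-! ### Measurability and composition for the whole protocol. -/

namespace FedOnce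

variable {m n : ℕ} (F : FedOnce m n)

theorem continuous_guestLoss (j : Fin m) (B : Dataset n F.Rec) (P : Equiv.Perm (Fin n)) :
    Continuous fun p : (Fin n → Vec (F.reprDim j)) × Vec (F.guestDim j) =>
      F.guestLoss j p.1 B P p.2 := by
  unfold guestLoss
  refine continuous_const.mul (continuous_finsetSum _ fun i _ => ?_)
  cases B i with
  | none => exact continuous_const
  | some r =>
    have := (F.guestModel_continuous j (r.1 j.succ)).comp
      (continuous_snd (X := Fin n → Vec (F.reprDim j)))
    simp only [Function.comp_def] at this
    fun_prop

theorem continuous_hostLoss (B : Dataset n F.Rec) :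
    Continuous fun p : ((j : Fin m) → Vec (F.guestDim j)) × Vec F.hostDim =>
      F.hostLoss p.1 B p.2 := by
  unfold hostLoss
  refine continuous_const.mul (continuous_finsetSum _ fun i _ => ?_)
  cases B i with
  | none => exact continuous_const
  | some r =>
    have h : Continuous fun p : ((j : Fin m) → Vec (F.guestDim j)) × Vec F.hostDim =>
        (p.2, fun j => F.guestModel j (p.1 j) (r.1 j.succ)) :=
      continuous_snd.prodMk (continuous_pi fun j =>
        (F.guestModel_continuous j _).comp ((continuous_apply j).comp continuous_fst))
    have := (F.hostModel_continuous (r.1 0)).comp h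
    simp only [Function.comp_def] at this
    fun_prop

theorem measurable_bestPerms (j : Fin m) (B : Dataset n F.Rec) :
    Measurable fun p : (Fin n → Vec (F.reprDim j)) × Vec (F.guestDim j) =>
      F.bestPerms j p.1 B p.2 := by
  have hcont := F.continuous_guestLoss j B
  refine measurable_set_iff.2 fun P => ?_
  refine Measurable.and measurable_const (Measurable.forall fun P' => Measurable.imp
    measurable_const ?_)
  exact measurableSet_setOfPred.1 (measurableSet_le (hcont P).measurable (hcont P').measurable)

theorem measurable_guestGrad (j : Fin m) (B : Dataset n F.Rec) :
    Measurable fun p : (Fin n → Vec (F.reprDim j)) × Vec (F.guestDim j) =>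
      F.guestGrad j p.1 B p.2 := by
  classical
  -- This exhibits the tie-breaking as a function of the set of minimizers alone.
  have e : ∀ p : (Fin n → Vec (F.reprDim j)) × Vec (F.guestDim j), F.bestPerm j p.1 B p.2 =
      if h : (F.bestPerms j p.1 B p.2).Nonempty then h.some else 1 :=
    fun p => (dif_pos (F.bestPerms_nonempty j p.1 B p.2)).symm
  simp only [guestGrad, e]
  exact measurable_gradient_choice (f := fun P C θ => F.guestLoss j C B P θ)
    (fun P => F.continuous_guestLoss j B P) (F.measurable_bestPerms j B)
    fun s => if h : s.Nonempty then h.some else 1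

theorem measurable_hostGrad (B : Dataset n F.Rec) :
    Measurable fun p : ((j : Fin m) → Vec (F.guestDim j)) × Vec F.hostDim =>
      F.hostGrad p.1 B p.2 :=
  measurable_gradient_with_param (f := fun Θ w => F.hostLoss Θ B w) (F.continuous_hostLoss B)

variable {q : ℝ} (T : ℕ) (D D' : Dataset n F.Rec)

theorem measurable_guestStep (q σ : ℝ) (j : Fin m) (t : ℕ) :
    Measurable fun p : (Fin n → Vec (F.reprDim j)) × Vec (F.guestDim j) =>
      noisyStep q σ F.clipNorm (F.guestRate j t) (F.guestGrad j p.1) D p.2 :=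
  measurable_noisyStep q σ F.clipNorm (F.guestRate j t) (F.measurable_guestGrad j) D

theorem measurable_hostStep (q σ : ℝ) (t : ℕ) :
    Measurable fun p : ((j : Fin m) → Vec (F.guestDim j)) × Vec F.hostDim =>
      noisyStep q σ F.clipNorm (F.hostRate t) (F.hostGrad p.1) D p.2 :=
  measurable_noisyStep q σ F.clipNorm (F.hostRate t) F.measurable_hostGrad D

theorem measurable_guestTrajectory (hq₀ : 0 ≤ q) (hq₁ : q ≤ 1) (σ : ℝ) (j : Fin m) :
    Measurable fun C => trajectory (F.guestInit j)
      (fun t => noisyStep q σ F.clipNorm (F.guestRate j t) (F.guestGrad j C) D) T :=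
  have := F.guestInit_prob j
  measurable_trajectory (F.measurable_guestStep D q σ j)
    (fun _ _ _ => isProbabilityMeasure_noisyStep hq₀ hq₁ _ _ _ _ _ _) T

theorem isProbabilityMeasure_guestTraining (hq₀ : 0 ≤ q) (hq₁ : q ≤ 1) (σ : ℝ) (j : Fin m) :
    IsProbabilityMeasure (F.guestTraining q σ j T D) := by
  have := F.guestInit_prob j
  have := F.targetLaw_prob j
  have : ∀ C, IsProbabilityMeasure (trajectory (F.guestInit j)
      (fun t => noisyStep q σ F.clipNorm (F.guestRate j t) (F.guestGrad j C) D) T) := fun C =>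
    isProbabilityMeasure_trajectory
      (fun t => (F.measurable_guestStep D q σ j t).comp (measurable_prodMk_left (x := C)))
    (fun _ _ => isProbabilityMeasure_noisyStep hq₀ hq₁ _ _ _ _ _ _) T
  exact isProbabilityMeasure_bind_of_measurable (F.measurable_guestTrajectory T D hq₀ hq₁ σ j)

theorem isProbabilityMeasure_hostTraining (hq₀ : 0 ≤ q) (hq₁ : q ≤ 1) (σ : ℝ)
    (Θ : (j : Fin m) → Vec (F.guestDim j)) :
    IsProbabilityMeasure (F.hostTraining q σ Θ T D) := by
  have := F.hostInit_prob
  exact isProbabilityMeasure_trajectory (init := F.hostInit)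
    (fun t => (F.measurable_hostStep D q σ t).comp (measurable_prodMk_left (x := Θ)))
    (fun _ _ => isProbabilityMeasure_noisyStep hq₀ hq₁ _ _ _ _ _ _) T

theorem measurable_hostTraining (hq₀ : 0 ≤ q) (hq₁ : q ≤ 1) (σ : ℝ) :
    Measurable fun Θ => F.hostTraining q σ Θ T D :=
  have := F.hostInit_prob
  measurable_trajectory (F.measurable_hostStep D q σ)
    (fun _ _ _ => isProbabilityMeasure_noisyStep hq₀ hq₁ _ _ _ _ _ _) T

variable {T : Fin (m + 1) → ℕ}

theorem measurable_run_kernel (hq₀ : 0 ≤ q) (hq₁ : q ≤ 1) (σ : ℝ) :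
    Measurable fun h : (j : Fin m) → Fin (T j.succ + 1) → Vec (F.guestDim j) =>
      (F.hostTraining q σ (fun j => h j (Fin.last _)) (T 0) D).map fun w =>
        ((h, w) : F.Transcript T) := by
  have := F.isProbabilityMeasure_hostTraining (T 0) D hq₀ hq₁ σ
  have hlast : Measurable fun h : (j : Fin m) → Fin (T j.succ + 1) → Vec (F.guestDim j) =>
      fun j => h j (Fin.last _) := by fun_prop
  exact measurable_map_of_uncurry
    (κ := fun h : (j : Fin m) → Fin (T j.succ + 1) → Vec (F.guestDim j) =>
      F.hostTraining q σ (fun j => h j (Fin.last _)) (T 0) D)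
    ((F.measurable_hostTraining (T 0) D hq₀ hq₁ σ).comp hlast) measurable_id

theorem isProbabilityMeasure_run (hq₀ : 0 ≤ q) (hq₁ : q ≤ 1) (σ : ℝ) :
    IsProbabilityMeasure (F.run T q σ D) := by
  have := fun j : Fin m => F.isProbabilityMeasure_guestTraining (T j.succ) D hq₀ hq₁ σ j
  have := F.isProbabilityMeasure_hostTraining (T 0) D hq₀ hq₁ σ
  have := fun h : (j : Fin m) → Fin (T j.succ + 1) → Vec (F.guestDim j) =>
    Measure.isProbabilityMeasure_map (μ := F.hostTraining q σ (fun j => h j (Fin.last _)) (T 0) D)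
      (f := fun w => ((h, w) : F.Transcript T)) (by fun_prop)
  exact isProbabilityMeasure_bind_of_measurable (F.measurable_run_kernel D hq₀ hq₁ σ)

/-- The independent guests contribute a product of constants, and the host, whose bound is uniform
in the representations received, contributes one more. Initial parameters and targets have
data-independent laws and cost nothing. -/
theorem holderDom_run {β : ℝ} (hβ : 1 ≤ β) {A : ℝ≥0∞} (hq₀ : 0 ≤ q) (hq₁ : q ≤ 1) (σ : ℝ)
    (h : ∀ (d : ℕ) (η : ℝ) (grad : Dataset n F.Rec → Vec d → Vec d) (θ : Vec d),
      HolderDom β A (noisyStep q σ F.clipNorm η grad D θ)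
        (noisyStep q σ F.clipNorm η grad D' θ)) :
    HolderDom β (A ^ ∑ j, T j) (F.run T q σ D) (F.run T q σ D') := by
  have hβ₀ : 0 < β := zero_lt_one.trans_le hβ
  have hguest : ∀ j : Fin m, HolderDom β (A ^ T j.succ) (F.guestTraining q σ j (T j.succ) D)
      (F.guestTraining q σ j (T j.succ) D') := fun j => by
    have := F.guestInit_prob j
    have := F.targetLaw_prob j
    rw [← one_mul (A ^ T j.succ)]
    refine (HolderDom.refl hβ (F.targetLaw j)).bind hβ₀
      (F.measurable_guestTrajectory _ D hq₀ hq₁ σ j)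
      (F.measurable_guestTrajectory _ D' hq₀ hq₁ σ j) fun C => ?_
    exact holderDom_trajectory hβ
      (fun t => (F.measurable_guestStep D q σ j t).comp (measurable_prodMk_left (x := C)))
      (fun _ _ => isProbabilityMeasure_noisyStep hq₀ hq₁ _ _ _ _ _ _)
      (fun t => (F.measurable_guestStep D' q σ j t).comp (measurable_prodMk_left (x := C)))
      (fun _ _ => isProbabilityMeasure_noisyStep hq₀ hq₁ _ _ _ _ _ _) (fun _ _ => h _ _ _ _) _
  have hhost : ∀ Θ, HolderDom β (A ^ T 0) (F.hostTraining q σ Θ (T 0) D)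
      (F.hostTraining q σ Θ (T 0) D') := fun Θ => by
    have := F.hostInit_prob
    exact holderDom_trajectory hβ
      (fun t => (F.measurable_hostStep D q σ t).comp (measurable_prodMk_left (x := Θ)))
      (fun _ _ => isProbabilityMeasure_noisyStep hq₀ hq₁ _ _ _ _ _ _)
      (fun t => (F.measurable_hostStep D' q σ t).comp (measurable_prodMk_left (x := Θ)))
      (fun _ _ => isProbabilityMeasure_noisyStep hq₀ hq₁ _ _ _ _ _ _) (fun _ _ => h _ _ _ _) _
  have := fun j : Fin m => F.isProbabilityMeasure_guestTraining (T j.succ) D hq₀ hq₁ σ j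
  have := fun j : Fin m => F.isProbabilityMeasure_guestTraining (T j.succ) D' hq₀ hq₁ σ j
  have e : A ^ ∑ j, T j = (∏ j : Fin m, A ^ T j.succ) * A ^ T 0 := by
    rw [Fin.sum_univ_succ, pow_add, Finset.prod_pow_eq_pow_sum, mul_comm]
  rw [e]
  exact (HolderDom.pi hβ₀ hguest).bind hβ₀ (F.measurable_run_kernel D hq₀ hq₁ σ)
    (F.measurable_run_kernel D' hq₀ hq₁ σ) fun _ => (hhost _).map measurable_prodMk_left

theorem isDP_release_of_isDP_run {ε δ σ : ℝ} (h : IsDP ε δ (F.run T q σ)) :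
    IsDP ε δ (F.release T q σ) := by
  intro D D' hD S hS
  have hm : Measurable fun p : F.Transcript T =>
      ((fun j => p.1 j (Fin.last _), p.2 (Fin.last _)) :
        ((j : Fin m) → Vec (F.guestDim j)) × Vec F.hostDim) := by fun_prop
  rw [release, release, Measure.map_apply hm hS, Measure.map_apply hm hS]
  exact h D D' hD _ (hm hS)

end FedOnce

/-! ### From moments to differential privacy. -/

namespace HolderDom

variable {Y : Type*} [MeasurableSpace Y]

theorem measure_le {β : ℝ} (hβ : 0 < β) {A : ℝ≥0∞} {P Q : Measure Y} (h : HolderDom β A P Q)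
    {S : Set Y} (hS : MeasurableSet S) : P S ≤ A * Q S ^ β⁻¹ := by
  have h1 := h (S.indicator 1) (measurable_one.indicator hS)
  have h2 : ∀ y, S.indicator (1 : Y → ℝ≥0∞) y ^ β = S.indicator 1 y := fun y => by
    by_cases hy : y ∈ S <;> simp [hy, hβ]
  simp_rw [h2] at h1
  rwa [lintegral_indicator_one hS, lintegral_indicator_one hS] at h1

/-- Testing on `S` gives `P S ^ (n + 1) ≤ E * Q S ^ n`. If the claim failed, then `Q S ≤ exp (-ε) *
P S`, and dividing by `P S ^ n` would give `P S ≤ E * exp (-n * ε) ≤ δ`, a contradiction. -/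
theorem measureReal_le_exp_mul_add {P Q : Measure Y} [IsFiniteMeasure P] [IsFiniteMeasure Q]
    {n N : ℕ} (hn : 1 ≤ n) {q a ε δ : ℝ} (hδ : 0 ≤ δ)
    (h : HolderDom ((n + 1) / n) (stepBound (n + 1) q a ^ N) P Q)
    (hexp : Real.exp (N * (subsampledConst * ((n + 1) ^ 2 * q ^ 2 * a ^ 2)) - n * ε) ≤ δ)
    {S : Set Y} (hS : MeasurableSet S) : P.real S ≤ Real.exp ε * Q.real S + δ := by
  have hn' : (0 : ℝ) < n := by exact_mod_cast hn
  set E := Real.exp (N * (subsampledConst * ((n + 1) ^ 2 * q ^ 2 * a ^ 2))) with hE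
  have h1 : P S ^ (n + 1) ≤ ENNReal.ofReal E * Q S ^ n := by
    have h2 := h.measure_le (by positivity) hS
    have h3 : (stepBound (n + 1) q a ^ N) ^ (n + 1) = ENNReal.ofReal E := by
      rw [← pow_mul, mul_comm, pow_mul, ← ENNReal.rpow_natCast (stepBound _ _ _), stepBound_rpow,
        ← ENNReal.ofReal_pow (Real.exp_pos _).le, ← Real.exp_nat_mul]
      push_cast
      rfl
    have h4 : (Q S ^ (((n : ℝ) + 1) / n)⁻¹) ^ (n + 1) = Q S ^ n := by
      rw [← ENNReal.rpow_natCast, ← ENNReal.rpow_mul, ← ENNReal.rpow_natCast]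
      congr 1
      push_cast
      field_simp
    calc P S ^ (n + 1) ≤ (stepBound (n + 1) q a ^ N * Q S ^ (((n : ℝ) + 1) / n)⁻¹) ^ (n + 1) := by
          gcongr
      _ = _ := by rw [mul_pow, h3, h4]
  have h2 : P.real S ^ (n + 1) ≤ E * Q.real S ^ n := by
    have := ENNReal.toReal_mono (by finiteness) h1
    rwa [ENNReal.toReal_mul, ENNReal.toReal_pow, ENNReal.toReal_pow,
      ENNReal.toReal_ofReal (Real.exp_pos _).le] at this
  by_contra! hlt
  have hQ : 0 ≤ Q.real S := measureReal_nonneg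
  have hP : 0 < P.real S := lt_of_le_of_lt (by positivity) hlt
  have h3 : Q.real S ≤ Real.exp (-ε) * P.real S := by
    have h4 : Real.exp ε * Q.real S ≤ P.real S := by linarith
    calc Q.real S = Real.exp (-ε) * (Real.exp ε * Q.real S) := by
          rw [← mul_assoc, ← Real.exp_add]; simp
      _ ≤ _ := by gcongr
  have h5 : P.real S * P.real S ^ n ≤ δ * P.real S ^ n := by
    calc P.real S * P.real S ^ n = P.real S ^ (n + 1) := (pow_succ' _ _).symm
      _ ≤ E * (Real.exp (-ε) * P.real S) ^ n := h2.trans (by gcongr)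
      _ = Real.exp (N * (subsampledConst * ((n + 1) ^ 2 * q ^ 2 * a ^ 2)) - n * ε) *
            P.real S ^ n := by
          rw [mul_pow, ← Real.exp_nat_mul, sub_eq_add_neg, Real.exp_add, hE]
          ring_nf
      _ ≤ δ * P.real S ^ n := by gcongr
  have h6 := le_of_mul_le_mul_right h5 (by positivity)
  linarith [mul_nonneg (Real.exp_pos ε).le hQ]

end HolderDom

theorem isDP_of_update {n : ℕ} {X Y : Type} [MeasurableSpace Y] {ε δ : ℝ} (hε : 0 ≤ ε)
    (hδ : 0 ≤ δ) {M : Dataset n X → Measure Y} (hM : ∀ D, IsProbabilityMeasure (M D))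
    (h : ∀ D i r, D i = none → ∀ S, MeasurableSet S →
      (M D).real S ≤ Real.exp ε * (M (Function.update D i (some r))).real S + δ ∧
        (M (Function.update D i (some r))).real S ≤ Real.exp ε * (M D).real S + δ) :
    IsDP ε δ M := by
  have key : ∀ D D' S, (M D).real S ≤ Real.exp ε * (M D').real S + δ →
      M D S ≤ ENNReal.ofReal (Real.exp ε) * M D' S + ENNReal.ofReal δ := by
    intro D D' S hle
    have h0 : 0 ≤ (M D').real S := measureReal_nonneg
    have h1 := ENNReal.ofReal_le_ofReal hle
    rwa [ENNReal.ofReal_add (by positivity) hδ, ENNReal.ofReal_mul (Real.exp_pos _).le,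
      ofReal_measureReal, ofReal_measureReal] at h1
  rintro D D' (rfl | ⟨i, r, hi, rfl⟩ | ⟨i, r, hi, rfl⟩) S hS
  · refine key _ _ _ ?_
    nlinarith [Real.one_le_exp hε, (measureReal_nonneg : 0 ≤ (M D).real S)]
  · exact key _ _ _ (h D i r hi S hS).1
  · exact key _ _ _ (h D' i r hi S hS).2

namespace FedOnce

variable {m n : ℕ} (F : FedOnce m n) {T : Fin (m + 1) → ℕ} {q σ ε δ : ℝ}

theorem isDP_run_of_moments {k : ℕ} (hk : 1 ≤ k) (hq₀ : 0 ≤ q) (hq₁ : q ≤ 1) (hσ : 0 < σ)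
    (hε : 0 ≤ ε) (hδ : 0 ≤ δ) (hkσ : (k + 1) * (2 / σ) ^ 2 ≤ 1 / 32)
    (hexp : Real.exp ((∑ j, T j : ℕ) * (subsampledConst * ((k + 1) ^ 2 * q ^ 2 * (2 / σ) ^ 2)) -
      k * ε) ≤ δ) : IsDP ε δ (F.run T q σ) := by
  have hM := fun D => F.isProbabilityMeasure_run (T := T) D hq₀ hq₁ σ
  have hβ := (holderConjugate_succ hk).symm.lt.le
  refine isDP_of_update hε hδ hM fun D i r hi S hS => ⟨?_, ?_⟩
  · refine HolderDom.measureReal_le_exp_mul_add hk hδ ?_ hexp hS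
    exact F.holderDom_run D _ hβ hq₀ hq₁ σ fun d η grad θ => holderDom_noisyStep_update hβ hq₀ hq₁
      (fun g g' => (holderDom_mixedStepLaw hk hq₀ hq₁ hσ F.clipNorm_pos hkσ η θ g g').1) hi r grad
  · refine HolderDom.measureReal_le_exp_mul_add hk hδ ?_ hexp hS
    exact F.holderDom_run _ D hβ hq₀ hq₁ σ fun d η grad θ => holderDom_update_noisyStep hβ hq₀ hq₁
      (fun g g' => (holderDom_mixedStepLaw hk hq₀ hq₁ hσ F.clipNorm_pos hkσ η θ g g').2) hi r grad

/-- With probability `(1 - q) ^ ∑ j, T j` a given record is never sampled. -/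
theorem isDP_run_of_never_sampled (hq₀ : 0 ≤ q) (hq₁ : q < 1) (hε : 0 ≤ ε)
    (hδ : 1 - (1 - q) ^ ∑ j, T j ≤ δ) (σ : ℝ) : IsDP ε δ (F.run T q σ) := by
  have hq : 0 < 1 - q := by linarith
  have hM := fun D => F.isProbabilityMeasure_run (T := T) D hq₀ hq₁.le σ
  have hc₁ : (1 - q) ^ ∑ j, T j ≤ 1 := pow_le_one₀ hq.le (by linarith)
  refine isDP_of_update hε (by linarith) hM fun D i r hi S hS => ?_
  have hdom := F.holderDom_run (T := T) D (Function.update D i (some r)) le_rfl hq₀ hq₁.le σ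
    fun d η grad θ => holderDom_noisyStep_update le_rfl hq₀ hq₁.le
      (holderDom_one_mixedStepLaw hq₁ σ F.clipNorm η θ) hi r grad
  set P := F.run T q σ D
  set Q := F.run T q σ (Function.update D i (some r))
  have : IsProbabilityMeasure P := hM _
  have : IsProbabilityMeasure Q := hM _
  set c := (1 - q) ^ ∑ j, T j with hc
  have hc₀ : 0 < c := by positivity
  -- From `c * P S ≤ Q S` one gets `P S - Q S ≤ (1 - c) * P S ≤ δ`. The reverse inequality follows
  -- below by passing to the complement.
  have hle : ∀ S, MeasurableSet S → P.real S ≤ Q.real S + δ := by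
    intro S hS
    have h1 := hdom.measure_le one_pos hS
    rw [inv_one, ENNReal.rpow_one, ← ENNReal.ofReal_pow (by positivity), inv_pow, ← hc] at h1
    have h2 := ENNReal.toReal_mono (by finiteness) h1
    rw [ENNReal.toReal_mul, ENNReal.toReal_ofReal (by positivity)] at h2
    change P.real S ≤ c⁻¹ * Q.real S at h2
    have h3 : c * P.real S ≤ Q.real S := by
      rwa [← div_eq_inv_mul, le_div_iff₀' hc₀] at h2
    nlinarith [(measureReal_le_one : P.real S ≤ 1), (measureReal_nonneg : 0 ≤ P.real S)]
  have h1 := Real.one_le_exp hε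
  constructor
  · nlinarith [hle S hS, (measureReal_nonneg : 0 ≤ Q.real S)]
  · have h2 := hle Sᶜ hS.compl
    rw [probReal_compl_eq_one_sub hS, probReal_compl_eq_one_sub hS] at h2
    nlinarith [(measureReal_nonneg : 0 ≤ P.real S)]

/-! ### Calibration of the noise and conclusion. -/

/-- The absolute constant in the lower bound on the noise multiplier. -/
noncomputable def noiseConst : ℝ := √(512 + 64 * subsampledConst)

theorem noiseConst_pos : 0 < noiseConst :=
  Real.sqrt_pos.2 (by linarith [subsampledConst_pos])

theorem isDP_run_of_le_log (hq₀ : 0 < q) (hq₁ : q ≤ 1) (hε : 0 < ε)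
    (hεq : ε < q ^ 2 * ∑ j, (T j : ℝ)) (hδ : 0 < δ) (hεδ : ε ≤ Real.log (1 / δ))
    (hσ : noiseConst * (q * √(Real.log (1 / δ) * ∑ j, (T j : ℝ)) / ε) ≤ σ) :
    IsDP ε δ (F.run T q σ) := by
  have hC := subsampledConst_pos
  have hsum : ((∑ j, T j : ℕ) : ℝ) = ∑ j, (T j : ℝ) := by push_cast; rfl
  rw [← hsum] at hεq hσ
  set N : ℝ := ((∑ j, T j : ℕ) : ℝ) with hN
  set L := Real.log (1 / δ) with hL
  have hL₀ : 0 < L := hε.trans_le hεδ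
  have hN₀ : 0 < N := by
    have : 0 < q ^ 2 * N := hε.trans hεq
    exact pos_of_mul_pos_right this (by positivity)
  have hσ₀ : 0 < σ := lt_of_lt_of_le (by have := noiseConst_pos; positivity) hσ
  -- The summand `512` gives `16 / K ≤ 1 / 32`, the admissibility of the moment order; the summand
  -- `64 * subsampledConst` keeps the accumulated log-moment below `L`.
  set K := 512 + 64 * subsampledConst with hK
  have hσ2 : K * q ^ 2 * (L * N) / ε ^ 2 ≤ σ ^ 2 := by
    calc K * q ^ 2 * (L * N) / ε ^ 2 = (noiseConst * (q * √(L * N) / ε)) ^ 2 := by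
          rw [mul_pow, div_pow, mul_pow, Real.sq_sqrt (by positivity), noiseConst,
            Real.sq_sqrt (by positivity)]
          ring
      _ ≤ σ ^ 2 := by
          have := noiseConst_pos
          gcongr
  have ha : (2 / σ) ^ 2 ≤ 4 * ε ^ 2 / (K * q ^ 2 * (L * N)) := by
    rw [div_pow, div_le_div_iff₀ (by positivity) (by positivity)]
    rw [div_le_iff₀ (by positivity)] at hσ2
    linarith
  -- This order makes `k * ε ≥ 2 * L`, leaving `exp (L - 2 * L) = δ` after a log-moment of at most
  -- `L`. The assumption `ε ≤ L` absorbs the rounding, giving `k + 1 ≤ 4 * L / ε`.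
  set k := ⌈2 * L / ε⌉₊ with hk
  have hk₁ : 2 * L / ε ≤ k := Nat.le_ceil _
  have hk₂ : (k : ℝ) < 2 * L / ε + 1 := Nat.ceil_lt_add_one (by positivity)
  have hk₀ : 1 ≤ k := Nat.one_le_ceil_iff.2 (by positivity)
  have hLε : 1 ≤ L / ε := (one_le_div hε).2 hεδ
  have hk₃ : (k : ℝ) + 1 ≤ 4 * L / ε := by
    rw [mul_div_assoc] at hk₂ ⊢
    linarith
  have hkε : 2 * L ≤ k * ε := (div_le_iff₀ hε).1 hk₁
  refine F.isDP_run_of_moments hk₀ hq₀.le hq₁ hσ₀ hε.le hδ.le ?_ ?_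
  · calc ((k : ℝ) + 1) * (2 / σ) ^ 2
        ≤ (4 * L / ε) * (4 * ε ^ 2 / (K * q ^ 2 * (L * N))) := by gcongr
      _ = 16 * ε / (K * (q ^ 2 * N)) := by field_simp; ring
      _ ≤ 16 * (q ^ 2 * N) / (K * (q ^ 2 * N)) := by gcongr
      _ = 16 / K := by field_simp
      _ ≤ 1 / 32 := by
          rw [div_le_div_iff₀ (by positivity) (by norm_num)]
          linarith
  · have h1 : N * (subsampledConst * (((k : ℝ) + 1) ^ 2 * q ^ 2 * (2 / σ) ^ 2)) ≤ L := by
      calc N * (subsampledConst * (((k : ℝ) + 1) ^ 2 * q ^ 2 * (2 / σ) ^ 2))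
          ≤ N * (subsampledConst * ((4 * L / ε) ^ 2 * q ^ 2 *
              (4 * ε ^ 2 / (K * q ^ 2 * (L * N))))) := by gcongr
        _ = L * (64 * subsampledConst) / K := by field_simp; ring
        _ ≤ L := by
            rw [div_le_iff₀ (by positivity)]
            gcongr
            linarith
    have h2 : Real.exp (-L) = δ := by
      rw [hL, Real.log_div one_ne_zero hδ.ne', Real.log_one, zero_sub, neg_neg, Real.exp_log hδ]
    rw [← h2]
    exact Real.exp_le_exp.2 (by linarith)

end FedOnce

theorem mainTheorem1 :
    ∃ c₂ : ℝ, 0 < c₂ ∧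
      (∀ (m : ℕ) (T : Fin (m + 1) → ℕ) (q : ℝ), 0 < q → q < 1 →
        ∃ c₁ : ℝ, 0 < c₁ ∧
          ∀ ε δ σ : ℝ, 0 < ε → ε < c₁ * q ^ 2 * ∑ j, (T j : ℝ) → 0 < δ →
            c₂ * (q * √(Real.log (1 / δ) * ∑ j, (T j : ℝ)) / ε) ≤ σ →
            ∀ (n : ℕ) (F : FedOnce m n),
              IsDP ε δ (F.run T q σ) ∧ IsDP ε δ (F.release T q σ)) ∧
      (∃ c₁ : ℝ, 0 < c₁ ∧
        ∀ (m : ℕ) (T : Fin (m + 1) → ℕ) (q : ℝ), 0 < q → q ≤ 1 →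
          ∀ ε δ σ : ℝ, 0 < ε → ε < c₁ * q ^ 2 * ∑ j, (T j : ℝ) → 0 < δ →
            ε ≤ Real.log (1 / δ) →
            c₂ * (q * √(Real.log (1 / δ) * ∑ j, (T j : ℝ)) / ε) ≤ σ →
            ∀ (n : ℕ) (F : FedOnce m n),
              IsDP ε δ (F.run T q σ) ∧ IsDP ε δ (F.release T q σ)) := by
  refine ⟨FedOnce.noiseConst, FedOnce.noiseConst_pos, ?_, 1, one_pos, ?_⟩
  · intro m T q hq₀ hq₁
    have hsum : ((∑ j, T j : ℕ) : ℝ) = ∑ j, (T j : ℝ) := by push_cast; rfl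
    set S := ∑ j, (T j : ℝ)
    have hS : 0 ≤ S := hsum ▸ Nat.cast_nonneg _
    set c := (1 - q) ^ ∑ j, T j with hc
    have hc₀ : 0 < c := pow_pos (by linarith) _
    -- The first entry gives `ε < q ^ 2 * S`, the second `ε < c`; `S + 1` avoids dividing by zero
    -- when no party trains.
    refine ⟨min 1 (c / (q ^ 2 * (S + 1))), by positivity, ?_⟩
    intro ε δ σ hε hεS hδ hσ n F
    have hε₁ : ε < q ^ 2 * S := by
      refine hεS.trans_le ?_
      rw [mul_assoc]
      exact mul_le_of_le_one_left (by positivity) (min_le_left _ _)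
    have hε₂ : ε < c := by
      refine hεS.trans_le ?_
      calc min 1 (c / (q ^ 2 * (S + 1))) * q ^ 2 * S
          ≤ c / (q ^ 2 * (S + 1)) * q ^ 2 * (S + 1) := by
            gcongr
            · exact min_le_right _ _
            · linarith
        _ = c := by field_simp
    suffices h : IsDP ε δ (F.run T q σ) from ⟨h, F.isDP_release_of_isDP_run h⟩
    -- If `δ < 1 - c`, then `log (1 / δ) ≥ 1 - δ > c > ε`, so the moment bound applies; otherwise
    -- `δ` covers the event that the record is ever sampled.
    rcases le_or_gt (1 - c) δ with h | h
    · exact F.isDP_run_of_never_sampled hq₀.le hq₁ hε.le h σ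
    · refine F.isDP_run_of_le_log hq₀ hq₁.le hε hε₁ hδ ?_ hσ
      rw [one_div, Real.log_inv]
      linarith [Real.log_le_sub_one_of_pos hδ]
  · intro m T q hq₀ hq₁ ε δ σ hε hεS hδ hεδ hσ n F
    rw [one_mul] at hεS
    have h := F.isDP_run_of_le_log hq₀ hq₁ hε hεS hδ hεδ hσ
    exact ⟨h, F.isDP_release_of_isDP_run h⟩
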